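/- **Conventions.** A loop folder is a triple $(G,H,K)$ where $G$ is a group, $H\le G$, and $K\subseteq G$ contains $1$ and is a set of representatives of the right cosets of every conjugate $H^g$, $g\in G$. Its loop is $K$ with the operation $x\circ y$ determined by $H(x\circ y)=Hxy$. It is a Bol loop folder (of exponent $2$) if its loop satisfies the right Bol identity $((xy)z)y=x((yz)y)$ and has exponent $2$. A surjective homomorphism of loop folders $(G,H,K)\to(G',H',K')$ is a surjective group homomorphism $\alpha:G\to G'$ with $\alpha(H)=H'$ and $\alpha(K)=K'$. **Setting.** Let $G$ be a group with an elementary abelian normal subgroup $J$ of order $32$ such that $G/J\cong PGL(2,5)$, $J$ is isomorphic, as a $PGL(2,5)$-module, to the $6$-dimensional $\mathbb F_2$-permutation module on the projective line over $\mathbb F_5$ modulo its center (the submodule of fixed vectors), $[G,G]/[G,J]\cong SL(2,5)$, and $G$ splits over $[G,G]J$. Fix an isomorphism $G/J\cong S_5$. Put $J_0=[G,J]$, let $H=N_G(P)$ for a Sylow $5$-subgroup $P$ of $G$, let $c$ be an involution in $G\setminus [G,G]J$, and put $K=J_0\cup c^G$. Let $N$ be the $4$-dimensional submodule of vectors of coordinate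 sum $0$ in the $5$-dimensional permutation module of $S_5$ over $\mathbb F_2$. Let $U=N\oplus N$ be the $S_5$-module on which even permutations $g$ act by $u_1\oplus u_2\mapsto u_1g\oplus u_2g$ and odd permutations $g$ act by $u_1\oplus u_2\mapsto u_2g\oplus u_1g$. Regard $U$ as a $G$-module through $G\to G/J\cong S_5$. Let $W=\{u\oplus u: u\in N\}$ and let $T_1$ be a nonzero proper $H$-submodule of $U$ different from $W$. For an integer $k\ge 1$ put $\mathscr U=U^k$, $\mathscr W=W^k$, $\mathscr T_1=T_1^k$ and $\mathscr G=G\ltimes\mathscr U$. **Proposition.** Put $\mathscr H=H\ltimes\mathscr T_1$ and $\mathscr K=c^{\mathscr G}\cup(J_0\oplus\mathscr W)$. Then $(\mathscr G,\mathscr H,\mathscr K)$ is a Bol loop folder of exponent $2$, and $\mathscr K$ is the union of $\{1\}$ and of conjugacy classes of involutions of $\mathscr G$. Also $(G,H,K)$ is a Bol loop folder of exponent $2$ with $|K|=96$, and the projection $\mathscr G\to G$, whose kernel is $\mathscr U$, is a surjective homomorphism of loop folders from $(\mathscr G,\mathscr H,\mathscr K)$ to $(G,H,K)$. It induces a surjective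 homomorphism from the loop of $(\mathscr G,\mathscr H,\mathscr K)$ onto the loop of $(G,H,K)$ whose kernel is an elementary abelian group of order $2^{4k}$; in other words, the former loop is an extension of the elementary abelian group of order $2^{4k}$ by the latter loop, which has order $96$. -/

import Mathlib

open scoped MatrixGroups LinearAlgebra.Projectivization

noncomputable section

/-! ### Loops -/

/-- A loop: a set with a binary operation and a unit element such that `x * y = z` has a unique
solution whenever two of `x`, `y`, `z` are given. -/
class Loop (Q : Type*) extends MulOneClass Q where
  existsUnique_right : ∀ x z : Q, ∃! y : Q, x * y = z
  existsUnique_left : ∀ y z : Q, ∃! x : Q, x * y = z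

/-- The right Bol identity `((xy)z)y = x((yz)y)`, equivalently `R_y R_z R_y = R_{(yz)y}`
for the right multiplication maps. -/
def IsRightBol (Q : Type*) [Loop Q] : Prop :=
  ∀ x y z : Q, ((x * y) * z) * y = x * ((y * z) * y)

/-- The loop `Q` has exponent `2`. -/
def HasExponentTwo (Q : Type*) [Loop Q] : Prop :=
  (∀ x : Q, x * x = 1) ∧ ∃ x : Q, x ≠ 1

/-- `Q` is an extension of `A` by `B`: `ι` is an embedding of `A` onto the kernel of the
surjective homomorphism `p` from `Q` onto `B`. -/
def IsLoopExtension {A Q B : Type*} [Group A] [Loop Q] [Loop B] (ι : A →* Q) (p : Q →* B) : Prop :=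
  Function.Injective ι ∧ Function.Surjective p ∧ ∀ q : Q, p q = 1 ↔ ∃ a : A, ι a = q

/-! ### Loop folders -/

section Folder

variable {G : Type*} [Group G]

/-- `(G, H, K)` is a loop folder: `1 ∈ K`, and `K` is a set of representatives of the right
cosets of every conjugate of `H`. -/
structure IsLoopFolder (H : Subgroup G) (K : Set G) : Prop where
  one_mem : 1 ∈ K
  isComplement : ∀ g : G,
    Subgroup.IsComplement ((H.map (MulAut.conj g).toMonoidHom : Subgroup G) : Set G) K

namespace IsLoopFolder

variable {H : Subgroup G} {K : Set G}

theorem isComplement_self (h : IsLoopFolder H K) : Subgroup.IsComplement (H : Set G) K := by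
  have h1 := h.isComplement 1
  have h2 : H.map (MulAut.conj (1 : G)).toMonoidHom = H := by
    ext x; simp
  rwa [h2] at h1

/-- The underlying set of the loop of a loop folder is `K`. -/
def Q (_ : IsLoopFolder H K) : Type _ := K

/-- The element of `G` underlying an element of the loop of a folder. -/
def val {h : IsLoopFolder H K} (x : h.Q) : G := Subtype.val (p := (· ∈ K)) x

theorem val_mem {h : IsLoopFolder H K} (x : h.Q) : val x ∈ K :=
  Subtype.property (p := (· ∈ K)) x

/-- The element of `K` that represents the coset `Hg`. -/
def rep (h : IsLoopFolder H K) (g : G) : h.Q := (h.isComplement_self.equiv g).2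

theorem rep_eq_iff (h : IsLoopFolder H K) (g : G) (z : h.Q) :
    h.rep g = z ↔ g * (val z)⁻¹ ∈ H := by
  have hu := Subgroup.isComplement_iff_existsUnique_mul_inv_mem.1 h.isComplement_self g
  have h1 : g * (val (h.rep g))⁻¹ ∈ H := by
    have := h.isComplement_self.equiv_fst_eq_mul_inv g
    change g * ((h.isComplement_self.equiv g).2 : G)⁻¹ ∈ H
    rw [← this]
    exact Subtype.property _
  constructor
  · rintro rfl; exact h1
  · intro h2
    exact hu.unique h1 h2

/-- The loop of a folder: `x * y` is the element of `K` with `H(x * y) = Hxy`. -/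
instance (h : IsLoopFolder H K) : Loop h.Q where
  mul x y := h.rep (val x * val y)
  one := ⟨1, h.one_mem⟩
  one_mul x := (h.rep_eq_iff _ _).2 (by
    change 1 * val x * (val x)⁻¹ ∈ H
    simp)
  mul_one x := (h.rep_eq_iff _ _).2 (by
    change val x * 1 * (val x)⁻¹ ∈ H
    simp)
  existsUnique_right x z := by
    have hc := Subgroup.isComplement_iff_existsUnique_mul_inv_mem.1
      (h.isComplement (val x)⁻¹) ((val x)⁻¹ * val z)
    have key : ∀ y : h.Q, h.rep (val x * val y) = z ↔
        (val x)⁻¹ * val z * (val y)⁻¹ ∈ H.map (MulAut.conj (val x)⁻¹).toMonoidHom := by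
      intro y
      rw [rep_eq_iff, ← inv_mem_iff]
      constructor
      · intro hy
        exact ⟨_, hy, by simp [mul_assoc]⟩
      · rintro ⟨k, hk, hk2⟩
        have : k = (val x * val y * (val z)⁻¹)⁻¹ := by
          have h3 : (val x)⁻¹ * k * val x = (val x)⁻¹ * val z * (val y)⁻¹ := by
            simpa using hk2
          have h4 : k = val x * ((val x)⁻¹ * k * val x) * (val x)⁻¹ := by group
          rw [h4, h3]; group
        rw [← this]; exact hk
    obtain ⟨y, hy, huniq⟩ := hc
    exact ⟨y, (key y).2 hy, fun y' hy' => huniq y' ((key y').1 hy')⟩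
  existsUnique_left y z := by
    have hc := Subgroup.isComplement_iff_existsUnique_mul_inv_mem.1
      h.isComplement_self (val z * (val y)⁻¹)
    have key : ∀ x : h.Q, h.rep (val x * val y) = z ↔
        val z * (val y)⁻¹ * (val x)⁻¹ ∈ H := by
      intro x
      rw [rep_eq_iff, ← inv_mem_iff]
      simp [mul_assoc]
    obtain ⟨x, hx, huniq⟩ := hc
    exact ⟨x, (key x).2 hx, fun x' hx' => huniq x' ((key x').1 hx')⟩

end IsLoopFolder

/-- `(G, H, K)` is a Bol loop folder (of exponent `2`): it is a loop folder and its loop is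
a right Bol loop of exponent `2`. -/
def IsBolLoopFolder (H : Subgroup G) (K : Set G) : Prop :=
  ∃ h : IsLoopFolder H K, IsRightBol h.Q ∧ HasExponentTwo h.Q

/-- `K` is the union of `{1}` and of conjugacy classes of involutions of `G`. -/
def IsOneUnionInvolutionClasses (K : Set G) : Prop :=
  ∃ I : Set G, (∀ t ∈ I, orderOf t = 2) ∧ K = {1} ∪ ⋃ t ∈ I, conjugatesOf t

/-- A surjective homomorphism between the loop folders `(G, H, K)` and `(G', H', K')`. -/
def IsSurjectiveFolderHom {G' : Type*} [Group G'] (H : Subgroup G) (K : Set G)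
    (H' : Subgroup G') (K' : Set G') (α : G →* G') : Prop :=
  Function.Surjective α ∧ H.map α = H' ∧ α '' K = K'

end Folder

/-! ### Permutation modules and the groups under consideration -/

/-- The permutation module over `𝔽₂` of a group `G` acting on `X`. -/
def permRep (G X : Type*) [Group G] [MulAction G X] : Representation (ZMod 2) G (X → ZMod 2) where
  toFun g := LinearMap.funLeft (ZMod 2) (ZMod 2) (fun x => g⁻¹ • x)
  map_one' := by ext f x; simp [LinearMap.funLeft]
  map_mul' g h := by ext f x; simp [LinearMap.funLeft, mul_smul]

/-- The permutation module modulo its center, the submodule of fixed vectors. -/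
def permRepModCenter (G X : Type*) [Group G] [MulAction G X] :
    Representation (ZMod 2) G ((X → ZMod 2) ⧸ (permRep G X).invariants) :=
  (permRep G X).quotient (permRep G X).invariants (fun g v hv => by
    have : permRep G X g v = v := hv g
    simpa [Submodule.mem_comap, this] using hv)

instance fact_prime_five : Fact (Nat.Prime 5) := ⟨by norm_num⟩

/-- `J` is an elementary abelian normal subgroup of order `32` of `G`, `G/J ≅ PGL(2,5)`, and `J`
is the `𝔽₂`-permutation module of `PGL(2,5)` on the projective line over `𝔽₅` modulo its center.
Moreover, `[G,G]/[G,J] ≅ SL(2,5)` and `G` splits over `[G,G]J`. -/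
structure ConditionStar (G : Type*) [Group G] (J : Subgroup G) [J.Normal] : Prop where
  comm : ∀ x ∈ J, ∀ y ∈ J, x * y = y * x
  sq_eq_one : ∀ x ∈ J, x ^ 2 = 1
  card_eq : Nat.card J = 32
  perm : ∃ (φ : G ⧸ J ≃* PGL(2, ZMod 5))
    (α : Additive J ≃+ ((ℙ (ZMod 5) (Fin 2 → ZMod 5) → ZMod 2) ⧸
      (permRep PGL(2, ZMod 5) (ℙ (ZMod 5) (Fin 2 → ZMod 5))).invariants)),
    ∀ (g : G) (j : J), α (Additive.ofMul (MulAut.conjNormal g j)) =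
      permRepModCenter PGL(2, ZMod 5) (ℙ (ZMod 5) (Fin 2 → ZMod 5))
        (φ (QuotientGroup.mk g)) (α (Additive.ofMul j))
  quot_iso : Nonempty
    ((commutator G) ⧸ (⁅(⊤ : Subgroup G), J⁆.subgroupOf (commutator G)) ≃* SL(2, ZMod 5))
  splits : ∃ C : Subgroup G, Subgroup.IsComplement' (commutator G ⊔ J) C

/-! ### The `S₅`-modules `N` and `U` -/

/-- The `4`-dimensional component of the `5`-dimensional permutation module of `S₅` over `𝔽₂`. -/
def sumZero : Submodule (ZMod 2) (Fin 5 → ZMod 2) where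
  carrier := {v | ∑ i, v i = 0}
  zero_mem' := by simp
  add_mem' {v w} hv hw := by
    simp only [Set.mem_ofPred_eq] at hv hw ⊢
    simp [Finset.sum_add_distrib, hv, hw]
  smul_mem' a v hv := by
    simp only [Set.mem_ofPred_eq] at hv ⊢
    simp [← Finset.mul_sum, hv]

/-- The `S₅`-module `N`. -/
def repN : Representation (ZMod 2) (Equiv.Perm (Fin 5)) sumZero :=
  (permRep (Equiv.Perm (Fin 5)) (Fin 5)).subrepresentation sumZero (fun g v hv => by
    change ∑ i, v (g⁻¹ i) = 0
    rw [Equiv.sum_comp g⁻¹ v]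
    exact hv)

/-- The underlying space of the `S₅`-module `U = U₁ ⊕ U₂`, a direct sum of two copies of `N`. -/
abbrev UMod : Type := sumZero × sumZero

/-- The `S₅`-module `U`: even permutations act diagonally, odd permutations act diagonally and
then interchange the summands, that is, the transposition `c` maps `u₁ ⊕ u₂` to `u₂c ⊕ u₁c`. -/
def repU : Representation (ZMod 2) (Equiv.Perm (Fin 5)) UMod where
  toFun σ := if Equiv.Perm.sign σ = 1 then (repN σ).prodMap (repN σ)
    else ((repN σ).prodMap (repN σ)) ∘ₗ (LinearEquiv.prodComm (ZMod 2) sumZero sumZero).toLinearMap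
  map_one' := by
    rw [if_pos (by simp), map_one]
    rfl
  map_mul' σ τ := by
    rcases Int.units_eq_one_or (Equiv.Perm.sign σ) with h1 | h1 <;>
    rcases Int.units_eq_one_or (Equiv.Perm.sign τ) with h2 | h2 <;>
    · simp only [map_mul, h1, h2]
      refine LinearMap.ext fun x => ?_
      simp [show ¬ (-1 : ℤˣ) = 1 by decide]

/-- The submodule `W = {u ⊕ u | u ∈ N}` of `U`. -/
def WSub : Submodule (ZMod 2) UMod where
  carrier := {u | u.1 = u.2}
  zero_mem' := rfl
  add_mem' {u v} hu hv := by
    simp only [Set.mem_ofPred_eq] at hu hv ⊢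
    simp [hu, hv]
  smul_mem' a u hu := by
    simp only [Set.mem_ofPred_eq] at hu ⊢
    simp [hu]

/-! ### The group `𝓖 = G ⋉ U^k` and its subsets -/

section Split

variable {G : Type*} [Group G] (J : Subgroup G) [J.Normal] (e : G ⧸ J ≃* Equiv.Perm (Fin 5))

/-- `U` as a `G`-module, through `G → G/J ≅ S₅`. -/
def gRepU : Representation (ZMod 2) G UMod :=
  repU.comp (e.toMonoidHom.comp (QuotientGroup.mk' J))

/-- The componentwise action of `G` on `U^k`, by automorphisms of the (multiplicatively written)
additive group. -/
def powAction (k : ℕ) : G →* MulAut (Multiplicative (Fin k → UMod)) where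
  toFun g :=
    { toFun := fun u => Multiplicative.ofAdd fun i => gRepU J e g (u.toAdd i)
      invFun := fun u => Multiplicative.ofAdd fun i => gRepU J e g⁻¹ (u.toAdd i)
      left_inv := fun u => by simp
      right_inv := fun u => by simp
      map_mul' := fun u v => by
        refine congrArg Multiplicative.ofAdd (funext fun i => ?_)
        exact map_add (gRepU J e g) (u.toAdd i) (v.toAdd i) }
  map_one' := by
    refine MulEquiv.ext fun u => congrArg Multiplicative.ofAdd (funext fun i => ?_)
    rw [map_one]
    rfl
  map_mul' g h := by
    refine MulEquiv.ext fun u => congrArg Multiplicative.ofAdd (funext fun i => ?_)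
    rw [map_mul]
    rfl

/-- The group `𝓖 = G ⋉ U^k`. -/
abbrev ScrG (k : ℕ) : Type _ := Multiplicative (Fin k → UMod) ⋊[powAction J e k] G

/-- The subgroup `H ⋉ T^k` of `𝓖`, for an `H`-submodule `T` of `U`. -/
def scrH (k : ℕ) (H : Subgroup G) (T : Submodule (ZMod 2) UMod)
    (hT : ∀ h ∈ H, ∀ u ∈ T, gRepU J e h u ∈ T) : Subgroup (ScrG J e k) where
  carrier := {x | x.right ∈ H ∧ ∀ i, x.left.toAdd i ∈ T}
  one_mem' := ⟨H.one_mem, fun _ => T.zero_mem⟩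
  mul_mem' hx hy := ⟨H.mul_mem hx.1 hy.1, fun i =>
    T.add_mem (hx.2 i) (hT _ hx.1 _ (hy.2 i))⟩
  inv_mem' hx := ⟨H.inv_mem hx.1, fun i => hT _ (H.inv_mem hx.1) _ (T.neg_mem (hx.2 i))⟩

/-- The subset `K = J₀ ∪ c^G` of `G`, where `J₀ = [G,J]`. -/
def smallK (c : G) : Set G := ((⁅(⊤ : Subgroup G), J⁆ : Subgroup G) : Set G) ∪ conjugatesOf c

/-- The subset `𝓚 = c^𝓖 ∪ (J₀ ⊕ W^k)` of `𝓖`, where `J₀ = [G,J]`. -/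
def scrK (k : ℕ) (c : G) : Set (ScrG J e k) :=
  conjugatesOf (SemidirectProduct.inr c) ∪
    {x | x.right ∈ ⁅(⊤ : Subgroup G), J⁆ ∧ ∀ i, x.left.toAdd i ∈ WSub}

end Split

end

/-! The set `smallK J c` is closed under conjugation and consists of `1` and involutions. For such a
set it is enough to show that it is a transversal of one subgroup `H`: conjugation then gives
transversals of all conjugates of `H`. The Bol identity follows because `yzy` is a conjugate of `z`
by the involution `y`, hence lies in the set (`isBolLoopFolder_of_conj_mem`). The same remark serves
`scrK`, so the proof reduces to two transversal statements.

For `G` this is a count, `3840 = 40 * 96`. Elements of `K` in the same coset of `H` coincide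
(`eq_of_mul_inv_mem_normalizer`), while `|H| ≥ 40` and `|K| ≥ 96`. Regard `J` as the functions on
six points modulo constants. A group of order `5` fixes one point `p`, so `H` meets `J` in `1` and
the class of the indicator of `p`. That class has odd weight, so it is outside `J₀`, and it is moved
by every transposition of `S₅`, since transpositions act on the six points without fixed points. If
`x`, `y` are conjugates of `c` with `xy` in `H`, these facts together with the centrality of the
involution of `SL(2,5)` force `xy = 1`. The bound on `K` is `16 + 10 * 8`: over each of the ten
transpositions lie eight conjugates of `c`.

For `𝓖`, the set `𝓚` is fibred over `K`: the fibre is `W^k` over `J₀`, and over a conjugate of `c`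
acting as `σ` it is the `k`-th power of the fixed space of `σ` on `U` (`mem_scrK_iff`). A
transversal of `H` lifts to one of `H ⋉ T^k` once `T` is a complement in `U` to each of these
subspaces (`isComplement_scrK`). For this, `N` is viewed as the field of order `16` generated by a
`5`-cycle; `T` is then the graph of multiplication by an element of order `3`, and it avoids `W` and
the graph of every transposition (`isCompl_of_conj_rot_dbl`). -/

noncomputable section

/-! ### The symmetric group `S₅` -/

section SymmetricGroup

open Equiv

/-- The standard `5`-cycle `i ↦ i + 1`. -/
def rot : Perm (Fin 5) := ⟨fun i => i + 1, fun i => i + 4, by decide, by decide⟩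

/-- The `4`-cycle `i ↦ 2 i`, which normalizes the group generated by `rot`. -/
def dbl : Perm (Fin 5) := ⟨fun i => 2 * i, fun i => 3 * i, by decide, by decide⟩

theorem orderOf_rot : orderOf rot = 5 :=
  orderOf_eq_prime (by decide) (by decide)

theorem mem_zpowers_rot {g : Perm (Fin 5)} (h : g ∈ Subgroup.zpowers rot) :
    ∃ i : Fin 5, g = rot ^ (i : ℕ) := by
  rw [mem_zpowers_iff_mem_range_orderOf, orderOf_rot] at h
  simp only [Finset.mem_image, Finset.mem_range] at h
  obtain ⟨n, hn, rfl⟩ := h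
  exact ⟨⟨n, hn⟩, rfl⟩

theorem dbl_mul_rot : dbl * rot * dbl⁻¹ = rot ^ 2 := by decide

theorem exists_conj_rot {y : Perm (Fin 5)} (hy : orderOf y = 5) :
    ∃ g : Perm (Fin 5), y = g * rot * g⁻¹ := by
  have hc : ∀ z : Perm (Fin 5), orderOf z = 5 → z.IsCycle := fun z hz =>
    Perm.isCycle_of_prime_order (by rw [hz]; norm_num) (by
      rw [hz]
      exact (Finset.card_le_univ _).trans_lt (by simp))
  have h : IsConj rot y := (hc _ orderOf_rot).isConj (hc _ hy) (by
    rw [← (hc _ orderOf_rot).orderOf, ← (hc _ hy).orderOf, orderOf_rot, hy])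
  obtain ⟨g, hg⟩ := isConj_iff.1 h
  exact ⟨g, hg.symm⟩

theorem swap_conj_rot (a b : Fin 5) (hab : a ≠ b) (i : Fin 5) :
    swap a b * rot * (swap a b)⁻¹ ≠ rot ^ (i : ℕ) := by
  revert a b i; decide

set_option maxRecDepth 10000 in
theorem swap_mul_swap_conj_rot (a b c d : Fin 5) (i : Fin 5)
    (h : swap a b * swap c d * rot = rot ^ (i : ℕ) * (swap a b * swap c d)) :
    swap a b * swap c d * (swap a b * swap c d) = 1 := by
  revert a b c d i; decide

theorem conj_mem_zpowers_conj {G : Type*} [Group G] (g x y : G) :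
    g * x * g⁻¹ ∈ Subgroup.zpowers (g * y * g⁻¹) ↔ x ∈ Subgroup.zpowers y := by
  simp only [Subgroup.mem_zpowers_iff, conj_zpow]
  simp

theorem isSwap_inv_conj {σ : Perm (Fin 5)} (hσ : σ.IsSwap) (g : Perm (Fin 5)) :
    (g⁻¹ * σ * g).IsSwap := by
  obtain ⟨a, b, hab, rfl⟩ := hσ
  refine ⟨g⁻¹ a, g⁻¹ b, by simpa using hab, ?_⟩
  rw [mul_assoc, swap_mul_eq_mul_swap, inv_mul_cancel_left]

theorem isSwap_conj {σ : Perm (Fin 5)} (hσ : σ.IsSwap) (g : Perm (Fin 5)) :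
    (g * σ * g⁻¹).IsSwap := by
  simpa using isSwap_inv_conj hσ g⁻¹

theorem isSwap_conj_notMem_zpowers {σ y : Perm (Fin 5)} (hσ : σ.IsSwap) (hy : orderOf y = 5) :
    σ * y * σ⁻¹ ∉ Subgroup.zpowers y := by
  obtain ⟨g, rfl⟩ := exists_conj_rot hy
  intro h
  obtain ⟨a, b, hab, hg⟩ := isSwap_inv_conj hσ g
  have h1 : g * (swap a b * rot * (swap a b)⁻¹) * g⁻¹ ∈ Subgroup.zpowers (g * rot * g⁻¹) := by
    rw [← hg]; convert h using 1; group
  rw [conj_mem_zpowers_conj] at h1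
  obtain ⟨i, hi⟩ := mem_zpowers_rot h1
  exact swap_conj_rot a b hab i hi

/-- A product of two transpositions is trivial, a double transposition or a `3`-cycle, and no
`3`-cycle normalizes a subgroup of order `5`. After conjugating `y` to `rot` this is a finite check.
-/
theorem isSwap_mul_isSwap_sq {σ τ y : Perm (Fin 5)} (hσ : σ.IsSwap) (hτ : τ.IsSwap)
    (hy : orderOf y = 5) (h : σ * τ * y * (σ * τ)⁻¹ ∈ Subgroup.zpowers y) :
    σ * τ * (σ * τ) = 1 := by
  obtain ⟨g, rfl⟩ := exists_conj_rot hy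
  obtain ⟨a, b, -, hg⟩ := isSwap_inv_conj hσ g
  obtain ⟨c, d, -, hg'⟩ := isSwap_inv_conj hτ g
  have h1 : g * ((g⁻¹ * σ * g) * (g⁻¹ * τ * g) * rot * ((g⁻¹ * σ * g) * (g⁻¹ * τ * g))⁻¹) * g⁻¹ ∈
      Subgroup.zpowers (g * rot * g⁻¹) := by
    convert h using 1; group
  rw [conj_mem_zpowers_conj, hg, hg'] at h1
  obtain ⟨i, hi⟩ := mem_zpowers_rot h1
  have h2 := swap_mul_swap_conj_rot a b c d i (mul_inv_eq_iff_eq_mul.1 hi)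
  rw [← hg, ← hg'] at h2
  have h3 : σ * τ * (σ * τ) = g * (g⁻¹ * σ * g * (g⁻¹ * τ * g) * (g⁻¹ * σ * g * (g⁻¹ * τ * g))) *
    g⁻¹ := by group
  rw [h3, h2]; simp

/-- An involution on five points has one or two `2`-cycles, and two make it even. -/
theorem isSwap_of_sign_of_sq {σ : Perm (Fin 5)} (hs : σ.sign ≠ 1) (h2 : σ ^ 2 = 1) :
    σ.IsSwap := by
  have h1 : σ ≠ 1 := fun h => hs (by simp [h])
  have ho : orderOf σ = 2 := orderOf_eq_prime h2 h1
  obtain ⟨n, hn⟩ := Perm.cycleType_prime_order (σ := σ) (by rw [ho]; norm_num)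
  rw [ho] at hn
  have hsum : (n + 1) * 2 ≤ 5 := by
    have := Perm.sum_cycleType σ
    rw [hn, Multiset.sum_replicate, smul_eq_mul] at this
    rw [this]
    exact (Finset.card_le_univ _).trans (by simp)
  have hn2 : n < 2 := by omega
  rw [← Perm.card_support_eq_two, ← Perm.sum_cycleType, hn, Multiset.sum_replicate]
  interval_cases n
  · rfl
  · exact absurd (by rw [Perm.sign_of_cycleType, hn]; decide) hs

theorem eq_one_of_commute_even {π : Perm (Fin 5)}
    (h : ∀ s : Perm (Fin 5), s.sign = 1 → s * π = π * s) : π = 1 := by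
  by_contra hne
  obtain ⟨a, ha⟩ : ∃ a, π a ≠ a := by
    by_contra! h'
    exact hne (Equiv.ext h')
  obtain ⟨c, d, hca, hcb, hda, hdb, hcd⟩ : ∃ c d : Fin 5, c ≠ a ∧ c ≠ π a ∧ d ≠ a ∧ d ≠ π a ∧
      c ≠ d := by
    have key : ∀ a b : Fin 5, ∃ c d : Fin 5, c ≠ a ∧ c ≠ b ∧ d ≠ a ∧ d ≠ b ∧ c ≠ d := by decide
    exact key a (π a)
  -- The even permutation `swap a c * swap a d` fixes `π a` but sends `a` to `d`, so commuting with
  -- it would give `π a = π d`.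
  have h1 := congrArg (fun f : Perm (Fin 5) => f a) (h (swap a c * swap a d) (by
    simp [Perm.sign_swap hca.symm, Perm.sign_swap hda.symm]))
  simp only [Perm.mul_apply, swap_apply_left] at h1
  rw [swap_apply_of_ne_of_ne ha hdb.symm, swap_apply_of_ne_of_ne ha hcb.symm] at h1
  rw [swap_apply_of_ne_of_ne hda hcd.symm] at h1
  exact hda (π.injective h1).symm

/-- Two different subgroups of order `5` would produce `25` distinct products inside a group of
order `20`. -/
theorem mem_zpowers_of_card_eq_twenty {S : Subgroup (Perm (Fin 5))} (hS : Nat.card S = 20)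
    {y z : Perm (Fin 5)} (hy : y ∈ S) (hz : z ∈ S) (hy5 : orderOf y = 5) (hz5 : orderOf z = 5) :
    z ∈ Subgroup.zpowers y := by
  by_contra hzy
  have hd : Disjoint (Subgroup.zpowers y) (Subgroup.zpowers z) := by
    have : Fact (Nat.card (Subgroup.zpowers z)).Prime := ⟨by
      rw [Nat.card_zpowers, hz5]; norm_num⟩
    rcases ((Subgroup.zpowers y).subgroupOf (Subgroup.zpowers z)).eq_bot_or_eq_top_of_prime_card
      with h | h
    · exact Subgroup.subgroupOf_eq_bot.1 h
    · exact absurd (Subgroup.subgroupOf_eq_top.1 h (Subgroup.mem_zpowers z)) hzy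
  have hinj := Subgroup.mul_injective_of_disjoint hd
  let f : Subgroup.zpowers y × Subgroup.zpowers z → S := fun g =>
    ⟨(g.1 : Perm (Fin 5)) * g.2, S.mul_mem ((Subgroup.zpowers_le.2 hy) g.1.2)
      ((Subgroup.zpowers_le.2 hz) g.2.2)⟩
  have hf : Function.Injective f := fun a b h => hinj (congrArg Subtype.val h)
  have := Nat.card_le_card_of_injective f hf
  rw [Nat.card_prod, Nat.card_zpowers, Nat.card_zpowers, hy5, hz5, hS] at this
  omega

/-! ### Transitive actions of `S₅` on six points. -/

section SixPoints

variable {X : Type*} [MulAction (Perm (Fin 5)) X] [MulAction.IsPretransitive (Perm (Fin 5)) X]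

theorem card_stabilizer_of_card_eq_six (hX : Nat.card X = 6) (p : X) :
    Nat.card (MulAction.stabilizer (Perm (Fin 5)) p) = 20 := by
  have h1 := (MulAction.stabilizer (Perm (Fin 5)) p).card_mul_index
  rw [MulAction.index_stabilizer_of_transitive, hX, Nat.card_eq_fintype_card (α := Perm _),
    Fintype.card_perm, Fintype.card_fin] at h1
  have : Nat.factorial 5 = 120 := rfl
  omega

/-- A point stabilizer has order `20`, so its subgroup of order `5` is unique and hence normalized
by the whole stabilizer; a transposition normalizes no such subgroup. -/
theorem isSwap_smul_ne (hX : Nat.card X = 6) {σ : Perm (Fin 5)} (hσ : σ.IsSwap) (p : X) :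
    σ • p ≠ p := by
  intro h
  have hS := card_stabilizer_of_card_eq_six hX p
  have : Fact (Nat.Prime 5) := ⟨by norm_num⟩
  obtain ⟨⟨y, hy⟩, hy5⟩ := exists_prime_orderOf_dvd_card'
    (G := MulAction.stabilizer (Perm (Fin 5)) p) 5 (by rw [hS]; norm_num)
  rw [Subgroup.orderOf_mk] at hy5
  refine isSwap_conj_notMem_zpowers hσ hy5 (mem_zpowers_of_card_eq_twenty hS hy
    ?_ hy5 ?_)
  · have hσ' : σ ∈ MulAction.stabilizer (Perm (Fin 5)) p := h
    exact Subgroup.mul_mem _ (Subgroup.mul_mem _ hσ' hy) (Subgroup.inv_mem _ hσ')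
  · exact ((MulAut.conj σ).orderOf_eq y).trans hy5

/-- Since `6 ≡ 1` modulo `5` there is a fixed point. The element cannot act trivially, so it has an
orbit of length `5`, which must be everything else. -/
theorem exists_fixedPoint_of_orderOf_eq_five (hX : Nat.card X = 6) {y : Perm (Fin 5)}
    (hy : orderOf y = 5) :
    ∃ p : X, y • p = p ∧ ∀ q r : X, q ≠ p → r ≠ p → ∃ n : ℕ, y ^ n • q = r := by
  have : Finite X := Nat.finite_of_card_ne_zero (by omega)
  have : Fact (Nat.Prime 5) := ⟨by norm_num⟩
  have hc : Nat.card (Subgroup.zpowers y) = 5 := by rw [Nat.card_zpowers, hy]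
  have hp : IsPGroup 5 (Subgroup.zpowers y) := IsPGroup.of_card (n := 1) (by rw [hc]; rfl)
  have hmod := hp.card_modEq_card_fixedPoints X
  obtain ⟨p, hp⟩ : (MulAction.fixedPoints (Subgroup.zpowers y) X).Nonempty := by
    by_contra h
    rw [Set.not_nonempty_iff_eq_empty] at h
    rw [h, hX] at hmod
    simp [Nat.ModEq] at hmod
  have hyp : y • p = p := hp ⟨y, Subgroup.mem_zpowers y⟩
  refine ⟨p, hyp, ?_⟩
  obtain ⟨r, hr⟩ : ∃ r : X, y • r ≠ r := by
    by_contra! h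
    -- If `y` acted trivially, so would its conjugates; all of them would lie in one stabilizer of
    -- order `20` and therefore in `zpowers y`.
    have hsw : (swap (0 : Fin 5) 1).IsSwap := ⟨0, 1, by decide, rfl⟩
    refine isSwap_conj_notMem_zpowers hsw hy
      (mem_zpowers_of_card_eq_twenty (card_stabilizer_of_card_eq_six hX p) (h p) ?_ hy ?_)
    · rw [MulAction.mem_stabilizer_iff, mul_smul, mul_smul, h, smul_inv_smul]
    · exact ((MulAut.conj _).orderOf_eq y).trans hy
  have hstab : MulAction.stabilizer (Subgroup.zpowers y) r = ⊥ := by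
    have : Fact (Nat.card (Subgroup.zpowers y)).Prime := ⟨by rw [hc]; norm_num⟩
    refine (Subgroup.eq_bot_or_eq_top_of_prime_card _).resolve_right fun h => hr ?_
    have : (⟨y, Subgroup.mem_zpowers y⟩ : Subgroup.zpowers y) ∈
        MulAction.stabilizer (Subgroup.zpowers y) r := h ▸ Subgroup.mem_top _
    exact this
  have horb : (MulAction.orbit (Subgroup.zpowers y) r).ncard = 5 := by
    rw [← MulAction.index_stabilizer, hstab, Subgroup.index_bot, hc]
  have hsub : MulAction.orbit (Subgroup.zpowers y) r ⊆ {p}ᶜ := by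
    rintro _ ⟨g, rfl⟩ hg
    have h2 : g • p = p := hp g
    have h3 : r = p := smul_left_cancel g (hg.trans h2.symm)
    exact hr (h3 ▸ hyp)
  have heq : MulAction.orbit (Subgroup.zpowers y) r = {p}ᶜ := by
    refine Set.eq_of_subset_of_ncard_le hsub ?_
    rw [horb, Set.ncard_compl, hX, Set.ncard_singleton]
  intro q s hq hs
  have hq' : q ∈ MulAction.orbit (Subgroup.zpowers y) r := heq ▸ hq
  have hs' : s ∈ MulAction.orbit (Subgroup.zpowers y) r := heq ▸ hs
  rw [← MulAction.orbit_eq_iff.2 hq'] at hs'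
  obtain ⟨⟨g, hg⟩, rfl⟩ := hs'
  obtain ⟨n, rfl⟩ := (mem_powers_iff_mem_zpowers.2 hg)
  exact ⟨n, rfl⟩

end SixPoints

end SymmetricGroup

/-! ### Submodules of the `S₅`-modules `N` and `U` -/

section Modules

open Equiv

/-- The linear combination `∑ aᵢ v(· + i)`, `i < 4`, of the images of `v` under powers of `rot`. -/
def rotComb (a : Fin 4 → ZMod 2) (v : Fin 5 → ZMod 2) : Fin 5 → ZMod 2 := fun j =>
  a 0 * v j + a 1 * v (j + 1) + a 2 * v (j + 2) + a 3 * v (j + 3)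

/-- The polynomial `1 + X + X² + X³ + X⁴` is irreducible over `𝔽₂`, so `rot` makes `N` a
one-dimensional space over the field of order `16`. The coefficient vectors `a` play the role of
field elements, and every nonzero vector generates `N`. -/
theorem exists_rotComb_eq (v : Fin 5 → ZMod 2) (hv : ∑ i, v i = 0) (hv0 : v ≠ 0) :
    ∃ a, rotComb a v = ![0, 1, 1, 1, 1] := by
  revert v; decide

theorem exists_eq_rotComb (v : Fin 5 → ZMod 2) (hv : ∑ i, v i = 0) :
    ∃ a, rotComb a ![0, 1, 1, 1, 1] = v := by
  revert v; decide

theorem dbl_fixed (v : Fin 5 → ZMod 2) (hv : ∑ i, v i = 0)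
    (h : (fun i => v (4 * i)) = v) :
    v = 0 ∨ v = ![0, 1, 1, 1, 1] ∨ v = ![0, 1, 0, 0, 1] ∨ v = ![0, 0, 1, 1, 0] := by
  revert v; decide

set_option maxRecDepth 10000 in
theorem rotComb_swap (a : Fin 4 → ZMod 2) (i j : Fin 5) (hij : i ≠ j) (v : Fin 5 → ZMod 2)
    (hv : v = ![0, 1, 0, 0, 1] ∨ v = ![0, 0, 1, 1, 0])
    (h : (fun l => rotComb a ![0, 1, 1, 1, 1] (swap i j l)) = rotComb a v) : a = 0 := by
  rcases hv with rfl | rfl <;> revert a i j <;> decide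

theorem rotComb_injective : Function.Injective fun a => rotComb a ![0, 1, 1, 1, 1] := by
  decide

theorem repN_apply (σ : Perm (Fin 5)) (v : sumZero) (i : Fin 5) :
    (repN σ v : Fin 5 → ZMod 2) i = (v : Fin 5 → ZMod 2) (σ⁻¹ i) := rfl

theorem repU_apply_of_sign_eq {σ : Perm (Fin 5)} (h : σ.sign = 1) (u : UMod) :
    repU σ u = (repN σ u.1, repN σ u.2) := by
  change (if σ.sign = 1 then _ else _ : UMod →ₗ[ZMod 2] UMod) u = _
  rw [if_pos h]; rfl

theorem repU_apply_of_sign_ne {σ : Perm (Fin 5)} (h : σ.sign ≠ 1) (u : UMod) :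
    repU σ u = (repN σ u.2, repN σ u.1) := by
  change (if σ.sign = 1 then _ else _ : UMod →ₗ[ZMod 2] UMod) u = _
  rw [if_neg h]; rfl

theorem mem_WSub {u : UMod} : u ∈ WSub ↔ u.1 = u.2 := Iff.rfl

theorem repU_mem_WSub (σ : Perm (Fin 5)) {u : UMod} (hu : u ∈ WSub) : repU σ u ∈ WSub := by
  rw [mem_WSub] at hu ⊢
  by_cases h : σ.sign = 1
  · simp [repU_apply_of_sign_eq h, hu]
  · simp [repU_apply_of_sign_ne h, hu]

theorem repU_mem_WSub_iff (σ : Perm (Fin 5)) {u : UMod} : repU σ u ∈ WSub ↔ u ∈ WSub := by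
  refine ⟨fun h => ?_, repU_mem_WSub σ⟩
  simpa using repU_mem_WSub σ⁻¹ h

/-- The vectors of `U` fixed by `σ`. -/
def fixU (σ : Perm (Fin 5)) : Submodule (ZMod 2) UMod := LinearMap.ker (repU σ - 1)

theorem mem_fixU {σ : Perm (Fin 5)} {u : UMod} : u ∈ fixU σ ↔ repU σ u = u := by
  rw [fixU, LinearMap.mem_ker, LinearMap.sub_apply, sub_eq_zero]; rfl

theorem sign_ne_one_of_isSwap {σ : Perm (Fin 5)} (hσ : σ.IsSwap) : σ.sign ≠ 1 := by
  rw [hσ.sign_eq]; decide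

theorem mul_self_of_isSwap {σ : Perm (Fin 5)} (hσ : σ.IsSwap) : σ * σ = 1 := by
  obtain ⟨a, b, -, rfl⟩ := hσ
  exact swap_mul_self a b

theorem repN_repN_of_isSwap {σ : Perm (Fin 5)} (hσ : σ.IsSwap) (v : sumZero) :
    repN σ (repN σ v) = v := by
  rw [← Module.End.mul_apply, ← map_mul, mul_self_of_isSwap hσ, map_one]; rfl

/-- An odd involution interchanges the two summands, so a fixed vector is determined by its first
component. Presenting all the relevant subspaces as graphs gives them dimension `4` at once. -/
theorem fixU_eq_graph {σ : Perm (Fin 5)} (hσ : σ.IsSwap) : fixU σ = (repN σ).graph := by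
  ext u
  rw [mem_fixU, repU_apply_of_sign_ne (sign_ne_one_of_isSwap hσ), LinearMap.mem_graph_iff,
    Prod.ext_iff]
  refine ⟨fun h => h.2.symm, fun h => ⟨?_, h.symm⟩⟩
  rw [h]
  exact repN_repN_of_isSwap hσ u.1

theorem WSub_eq_graph : WSub = (LinearMap.id : sumZero →ₗ[ZMod 2] sumZero).graph := by
  ext u
  rw [mem_WSub, LinearMap.mem_graph_iff]
  exact eq_comm

/-- The vector `(0, 1, 1, 1, 1)` of `N`. -/
def baseN : sumZero := ⟨![0, 1, 1, 1, 1], by change ∑ i, _ = _; decide⟩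

/-- The linear combination `∑ aᵢ rot⁻ⁱ`, `i < 4`, acting on `N`. -/
def rotEnd (a : Fin 4 → ZMod 2) : Module.End (ZMod 2) sumZero :=
  ∑ i, a i • repN (rot⁻¹ ^ (i : ℕ))

theorem coe_rotEnd (a : Fin 4 → ZMod 2) (v : sumZero) :
    (rotEnd a v : Fin 5 → ZMod 2) = rotComb a v := by
  funext j
  have h : ∀ (n : ℕ) (j : Fin 5), (rot⁻¹ ^ n)⁻¹ j = j + Fin.ofNat 5 n := by
    intro n j
    rw [inv_pow, inv_inv]
    induction n generalizing j with
    | zero => simp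
    | succ n ih =>
      rw [pow_succ, Perm.mul_apply, ih]
      change j + 1 + _ = _
      rw [add_assoc, add_comm 1]
      congr 1
      simp [Fin.ext_iff, Fin.val_add, Fin.ofNat]
  simp only [rotEnd, Fin.sum_univ_four, LinearMap.add_apply, LinearMap.smul_apply,
    Submodule.coe_add, Submodule.coe_smul, Pi.add_apply, Pi.smul_apply, repN_apply, h, smul_eq_mul]
  simp [rotComb, Fin.ofNat]

theorem exists_rotEnd_eq_baseN {v : sumZero} (hv : v ≠ 0) : ∃ a, rotEnd a v = baseN := by
  obtain ⟨a, ha⟩ := exists_rotComb_eq v v.2 (fun h => hv (Subtype.ext h))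
  exact ⟨a, Subtype.ext ((coe_rotEnd a v).trans ha)⟩

theorem exists_rotEnd_baseN_eq (v : sumZero) : ∃ a, rotEnd a baseN = v := by
  obtain ⟨a, ha⟩ := exists_eq_rotComb v v.2
  exact ⟨a, Subtype.ext ((coe_rotEnd a baseN).trans ha)⟩

theorem finrank_sumZero : Module.finrank (ZMod 2) sumZero = 4 := by
  let f : (Fin 4 → ZMod 2) →ₗ[ZMod 2] sumZero :=
    { toFun := fun a => rotEnd a baseN
      map_add' := fun a b => by simp [rotEnd, add_smul, Finset.sum_add_distrib]
      map_smul' := fun r a => by simp [rotEnd, mul_smul, Finset.smul_sum] }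
  have hf : Function.Bijective f := ⟨fun a b h => rotComb_injective (by
      have := congrArg (Subtype.val) h
      exact (coe_rotEnd a baseN).symm.trans (this.trans (coe_rotEnd b baseN))),
    exists_rotEnd_baseN_eq⟩
  rw [← (LinearEquiv.ofBijective f hf).finrank_eq]
  simp

theorem finrank_graph (f : sumZero →ₗ[ZMod 2] sumZero) :
    Module.finrank (ZMod 2) f.graph = 4 := by
  rw [LinearMap.graph_eq_range_prod, LinearMap.finrank_range_of_inj, finrank_sumZero]
  exact fun a b h => congrArg Prod.fst h

theorem isCompl_graph {T : Submodule (ZMod 2) UMod} (hT : Module.finrank (ZMod 2) T = 4)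
    {f : sumZero →ₗ[ZMod 2] sumZero} (h : Disjoint T f.graph) : IsCompl T f.graph := by
  refine ⟨h, codisjoint_iff.2 (Submodule.eq_top_of_disjoint _ _ ?_ h)⟩
  rw [hT, finrank_graph, Module.finrank_prod, finrank_sumZero]

/-! ### Subspaces of `U` invariant under `rot` and `dbl`. -/

section Invariant

variable {T : Submodule (ZMod 2) UMod}

theorem rotEnd_mem (hr : ∀ u ∈ T, repU rot⁻¹ u ∈ T) (a : Fin 4 → ZMod 2) {u : UMod}
    (hu : u ∈ T) : (rotEnd a u.1, rotEnd a u.2) ∈ T := by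
  have hpow : ∀ n : ℕ, (repN (rot⁻¹ ^ n) u.1, repN (rot⁻¹ ^ n) u.2) ∈ T := by
    intro n
    induction n with
    | zero => simpa using hu
    | succ n ih =>
      have := hr _ ih
      rw [repU_apply_of_sign_eq (by decide)] at this
      rw [pow_succ', map_mul]
      exact this
  have h : (rotEnd a u.1, rotEnd a u.2) =
      ∑ i : Fin 4, a i • ((repN (rot⁻¹ ^ (i : ℕ)) u.1, repN (rot⁻¹ ^ (i : ℕ)) u.2) : UMod) := by
    simp [rotEnd, Prod.ext_iff, Prod.fst_sum, Prod.snd_sum, LinearMap.sum_apply]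
  rw [h]
  exact Submodule.sum_mem _ fun i _ => T.smul_mem _ (hpow i)

/-- A nonzero vector of `0 ⊕ N` generates this summand under `rot`, and the odd permutation `dbl`
carries it to the other summand, which would make `T` everything. So `T` is the graph of a map. -/
theorem snd_eq_zero_of_mem (hr : ∀ u ∈ T, repU rot⁻¹ u ∈ T) (hd : ∀ u ∈ T, repU dbl⁻¹ u ∈ T)
    (htop : T ≠ ⊤) {v : sumZero} (hv : (0, v) ∈ T) : v = 0 := by
  by_contra hv0
  obtain ⟨a, ha⟩ := exists_rotEnd_eq_baseN hv0
  have h1 : ∀ w : sumZero, (0, w) ∈ T := by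
    intro w
    obtain ⟨b, hb⟩ := exists_rotEnd_baseN_eq w
    simpa [ha, hb] using rotEnd_mem hr b (rotEnd_mem hr a hv)
  have h2 : ∀ w : sumZero, (w, 0) ∈ T := by
    intro w
    have := hd _ (h1 (repN dbl w))
    rw [repU_apply_of_sign_ne (by decide)] at this
    simpa using this
  refine htop (eq_top_iff.2 fun u _ => ?_)
  simpa using T.add_mem (h2 u.1) (h1 u.2)

theorem eq_of_mem_of_mem (hr : ∀ u ∈ T, repU rot⁻¹ u ∈ T) (hd : ∀ u ∈ T, repU dbl⁻¹ u ∈ T)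
    (htop : T ≠ ⊤) {w v v' : sumZero} (hv : (w, v) ∈ T) (hv' : (w, v') ∈ T) : v = v' := by
  refine sub_eq_zero.1 (snd_eq_zero_of_mem hr hd htop ?_)
  simpa using T.sub_mem hv hv'

theorem exists_mem (hr : ∀ u ∈ T, repU rot⁻¹ u ∈ T) (hd : ∀ u ∈ T, repU dbl⁻¹ u ∈ T)
    (hbot : T ≠ ⊥) (htop : T ≠ ⊤) (w : sumZero) : ∃ v, (w, v) ∈ T := by
  obtain ⟨u, hu, hu0⟩ := T.ne_bot_iff.1 hbot
  have hu1 : u.1 ≠ 0 := by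
    intro h
    have h2 : u = (0, u.2) := Prod.ext h rfl
    rw [h2] at hu hu0
    exact hu0 (by rw [snd_eq_zero_of_mem hr hd htop hu]; rfl)
  obtain ⟨a, ha⟩ := exists_rotEnd_eq_baseN hu1
  obtain ⟨b, hb⟩ := exists_rotEnd_baseN_eq w
  have := rotEnd_mem hr b (rotEnd_mem hr a hu)
  simp only [ha, hb] at this
  exact ⟨_, this⟩

theorem finrank_invariant (hr : ∀ u ∈ T, repU rot⁻¹ u ∈ T) (hd : ∀ u ∈ T, repU dbl⁻¹ u ∈ T)
    (hbot : T ≠ ⊥) (htop : T ≠ ⊤) : Module.finrank (ZMod 2) T = 4 := by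
  let f : T →ₗ[ZMod 2] sumZero := (LinearMap.fst _ _ _).comp T.subtype
  have hf : Function.Bijective f := by
    refine ⟨?_, fun w => ?_⟩
    · rintro ⟨⟨a, b⟩, hu⟩ ⟨⟨a', b'⟩, hu'⟩ h
      obtain rfl : a = a' := h
      obtain rfl := eq_of_mem_of_mem hr hd htop hu hu'
      rfl
    · obtain ⟨v, hv⟩ := exists_mem hr hd hbot htop w
      exact ⟨⟨_, hv⟩, rfl⟩
  rw [(LinearEquiv.ofBijective f hf).finrank_eq, finrank_sumZero]

theorem disjoint_WSub (hr : ∀ u ∈ T, repU rot⁻¹ u ∈ T) (hd : ∀ u ∈ T, repU dbl⁻¹ u ∈ T)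
    (htop : T ≠ ⊤) (hW : T ≠ WSub) : Disjoint T WSub := by
  rw [Submodule.disjoint_def]
  rintro ⟨w, w'⟩ hu (rfl : w = w')
  by_contra h0
  have hw : w ≠ 0 := fun h => h0 (by rw [h]; rfl)
  obtain ⟨a, ha⟩ := exists_rotEnd_eq_baseN hw
  have h1 : ∀ v, (v, v) ∈ T := by
    intro v
    obtain ⟨b, hb⟩ := exists_rotEnd_baseN_eq v
    have := rotEnd_mem hr b (rotEnd_mem hr a hu)
    simpa only [ha, hb] using this
  refine hW (le_antisymm (fun u hu => ?_) fun u hu => ?_)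
  · exact eq_of_mem_of_mem hr hd htop (h1 u.1) hu
  · have h2 : u = (u.1, u.1) := Prod.ext rfl (mem_WSub.1 hu).symm
    rw [h2]; exact h1 _

/-- The vector `baseN` is fixed by `dbl`, which swaps the summands, so its partner `m` is fixed by
`dbl²`. In the field of order `16`, with `baseN` as `1`, this puts `m` in the subfield of order `4`.
The values `0` and `1` are excluded by `T` being a graph and by `T ≠ WSub`, leaving the two elements
of order `3`. -/
theorem exists_baseN_mem (hr : ∀ u ∈ T, repU rot⁻¹ u ∈ T) (hd : ∀ u ∈ T, repU dbl⁻¹ u ∈ T)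
    (hbot : T ≠ ⊥) (htop : T ≠ ⊤) (hW : T ≠ WSub) :
    ∃ m : sumZero, (baseN, m) ∈ T ∧
      ((m : Fin 5 → ZMod 2) = ![0, 1, 0, 0, 1] ∨ (m : Fin 5 → ZMod 2) = ![0, 0, 1, 1, 0]) := by
  obtain ⟨m, hm⟩ := exists_mem hr hd hbot htop baseN
  refine ⟨m, hm, ?_⟩
  have hbase : repN dbl⁻¹ baseN = baseN := by
    refine Subtype.ext (funext fun i => ?_)
    rw [repN_apply]
    revert i; decide
  have h1 := hd _ hm
  rw [repU_apply_of_sign_ne (by decide)] at h1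
  simp only [hbase] at h1
  -- A second application of `dbl⁻¹` returns `baseN` to the first component, so both partners of
  -- `baseN` can be compared.
  have h2 := hd _ h1
  rw [repU_apply_of_sign_ne (by decide)] at h2
  simp only [hbase] at h2
  have h3 := eq_of_mem_of_mem hr hd htop h2 hm
  have h4 : (fun i => (m : Fin 5 → ZMod 2) (4 * i)) = m := by
    funext i
    have := congrFun (congrArg Subtype.val h3) i
    rw [repN_apply, repN_apply] at this
    have key : ∀ i : Fin 5, 4 * i = dbl⁻¹⁻¹ (dbl⁻¹⁻¹ i) := by decide
    rw [← this, key]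
  rcases dbl_fixed m m.2 h4 with h | h | h
  · obtain rfl : m = 0 := Subtype.ext h
    rw [map_zero] at h1
    have := snd_eq_zero_of_mem hr hd htop h1
    exact absurd (congrFun (congrArg Subtype.val this) 1) (by decide)
  · obtain rfl : m = baseN := Subtype.ext h
    have := (Submodule.disjoint_def.1 (disjoint_WSub hr hd htop hW)) _ hm rfl
    exact absurd (congrFun (congrArg Subtype.val (congrArg Prod.fst this)) 1) (by decide)
  · exact h

/-- Every element of `T` has the form `(a • baseN, a • m)` for a field element `a`. Being fixed by a
transposition means that the transposition maps `a • baseN` to `a • m`, and for the two possible `m`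
a finite check leaves only `a = 0`. -/
theorem disjoint_fixU (hr : ∀ u ∈ T, repU rot⁻¹ u ∈ T) (hd : ∀ u ∈ T, repU dbl⁻¹ u ∈ T)
    (hbot : T ≠ ⊥) (htop : T ≠ ⊤) (hW : T ≠ WSub) {σ : Perm (Fin 5)} (hσ : σ.IsSwap) :
    Disjoint T (fixU σ) := by
  rw [Submodule.disjoint_def]
  rintro ⟨w, v⟩ hu hfix
  rw [fixU_eq_graph hσ, LinearMap.mem_graph_iff] at hfix
  simp only at hfix
  obtain ⟨m, hm, hm'⟩ := exists_baseN_mem hr hd hbot htop hW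
  obtain ⟨a, rfl⟩ := exists_rotEnd_baseN_eq w
  have h0 : (rotEnd a baseN, rotEnd a m) ∈ T := rotEnd_mem (u := (baseN, m)) hr a hm
  have h1 : v = rotEnd a m := eq_of_mem_of_mem hr hd htop hu h0
  obtain ⟨i, j, hij, rfl⟩ := hσ
  have hb : (baseN : Fin 5 → ZMod 2) = ![0, 1, 1, 1, 1] := rfl
  have h2 : a = 0 := by
    refine rotComb_swap a i j hij m hm' (funext fun l => ?_)
    have := congrFun (congrArg Subtype.val (h1.symm.trans hfix)) l
    rw [repN_apply, coe_rotEnd, coe_rotEnd, swap_inv, hb] at this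
    exact this.symm
  have h3 : rotEnd a = 0 := by simp [h2, rotEnd]
  rw [hfix, h3]; simp

end Invariant

/-- The subgroup `H` provides only conjugates of `rot` and `dbl`. Pulling `T` back along `repU π`
reduces to the standard elements; this preserves `WSub` and permutes the fixed spaces of the
transpositions. -/
theorem isCompl_of_conj_rot_dbl {T : Submodule (ZMod 2) UMod} (π : Perm (Fin 5))
    (hr : ∀ u ∈ T, repU (π * rot⁻¹ * π⁻¹) u ∈ T) (hd : ∀ u ∈ T, repU (π * dbl⁻¹ * π⁻¹) u ∈ T)
    (hbot : T ≠ ⊥) (htop : T ≠ ⊤) (hW : T ≠ WSub) :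
    IsCompl T WSub ∧ ∀ σ : Perm (Fin 5), σ.IsSwap → IsCompl T (fixU σ) := by
  have hmul : ∀ (σ τ : Perm (Fin 5)) (u : UMod), repU σ (repU τ u) = repU (σ * τ) u :=
    fun σ τ u => by rw [map_mul]; rfl
  have hone : ∀ u : UMod, repU 1 u = u := fun u => by rw [map_one]; rfl
  let E : UMod ≃ₗ[ZMod 2] UMod := LinearEquiv.ofLinearMap (repU π) (repU π⁻¹)
    (LinearMap.ext fun u => by
      rw [LinearMap.comp_apply, hmul, mul_inv_cancel, hone, LinearMap.id_apply])
    (LinearMap.ext fun u => by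
      rw [LinearMap.comp_apply, hmul, inv_mul_cancel, hone, LinearMap.id_apply])
  have hE : ∀ u, E u = repU π u := fun _ => rfl
  let F := (Submodule.orderIsoMapComap E).symm
  have hF : ∀ S u, u ∈ F S ↔ repU π u ∈ S := fun _ _ => Iff.rfl
  have hr' : ∀ u ∈ F T, repU rot⁻¹ u ∈ F T := by
    intro u hu
    rw [hF] at hu ⊢
    have := hr _ hu
    rwa [hmul, inv_mul_cancel_right, ← hmul] at this
  have hd' : ∀ u ∈ F T, repU dbl⁻¹ u ∈ F T := by
    intro u hu
    rw [hF] at hu ⊢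
    have := hd _ hu
    rwa [hmul, inv_mul_cancel_right, ← hmul] at this
  have hFW : F WSub = WSub := by
    ext u
    rw [hF, repU_mem_WSub_iff]
  have hbot' : F T ≠ ⊥ := by simpa using hbot
  have htop' : F T ≠ ⊤ := by simpa using htop
  have hW' : F T ≠ WSub := by
    rw [← hFW]; simpa using hW
  have hfr := finrank_invariant hr' hd' hbot' htop'
  constructor
  · rw [F.isCompl_iff, hFW, WSub_eq_graph]
    refine isCompl_graph hfr ?_
    rw [← WSub_eq_graph]
    exact disjoint_WSub hr' hd' htop' hW'
  · intro σ hσ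
    have hσ' := isSwap_inv_conj hσ π
    have hFσ : F (fixU σ) = fixU (π⁻¹ * σ * π) := by
      ext u
      have h : repU σ (repU π u) = repU π (repU (π⁻¹ * σ * π) u) := by
        rw [hmul, hmul, mul_assoc, mul_inv_cancel_left]
      rw [hF, mem_fixU, mem_fixU, h]
      exact E.injective.eq_iff
    rw [F.isCompl_iff, hFσ, fixU_eq_graph hσ']
    refine isCompl_graph hfr ?_
    rw [← fixU_eq_graph hσ']
    exact disjoint_fixU hr' hd' hbot' htop' hW' hσ'

end Modules

/-! ### Folders with a conjugation invariant set of involutions -/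

section Folder

variable {G : Type*} [Group G] {H : Subgroup G} {K : Set G}

/-- Conjugation by `g` carries transversals of `H` to transversals of its conjugate, and it
preserves `K`. -/
theorem isLoopFolder_of_conj_mem (h1 : 1 ∈ K) (hconj : ∀ g : G, ∀ x ∈ K, g * x * g⁻¹ ∈ K)
    (hc : Subgroup.IsComplement (H : Set G) K) : IsLoopFolder H K := by
  refine ⟨h1, fun g => ?_⟩
  have hinj : Function.Injective (MulAut.conj g) := (MulAut.conj g).injective
  rw [Subgroup.isComplement_iff_existsUnique_mul_inv_mem] at hc ⊢
  intro x
  obtain ⟨y, hy, huniq⟩ := hc (g⁻¹ * x * g)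
  have key : ∀ y : G, (x * y⁻¹ ∈ ((H.map (MulAut.conj g).toMonoidHom : Subgroup G) : Set G) ↔
      g⁻¹ * x * g * (g⁻¹ * y * g)⁻¹ ∈ (H : Set G)) := by
    intro y
    have h2 : x * y⁻¹ = MulAut.conj g (g⁻¹ * x * g * (g⁻¹ * y * g)⁻¹) := by
      simp only [MulAut.conj_apply]; group
    constructor
    · rintro ⟨k, hk, hk2⟩
      rw [h2] at hk2
      rw [← hinj hk2]; exact hk
    · intro h
      exact ⟨_, h, h2.symm⟩
  refine ⟨⟨g * y * g⁻¹, hconj g _ y.2⟩, (key _).2 ?_, ?_⟩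
  · simpa [mul_assoc] using hy
  · rintro ⟨z, hz⟩ hz'
    have hz2 := (key _).1 hz'
    have := huniq ⟨g⁻¹ * z * g, by simpa using hconj g⁻¹ z hz⟩ hz2
    rw [Subtype.ext_iff] at this
    refine Subtype.ext ?_
    simp only at this ⊢
    rw [← this]; group

namespace IsLoopFolder

theorem val_injective (h : IsLoopFolder H K) : Function.Injective (val (h := h)) :=
  Subtype.val_injective

theorem rep_val (h : IsLoopFolder H K) (x : h.Q) : h.rep (val x) = x :=
  (h.rep_eq_iff _ _).2 (by simp)

theorem mul_def (h : IsLoopFolder H K) (x y : h.Q) : x * y = h.rep (val x * val y) := rfl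

/-- The element of the loop of a folder given by an element of `K`. -/
def ofMem (h : IsLoopFolder H K) (x : G) (hx : x ∈ K) : h.Q := ⟨x, hx⟩

@[simp]
theorem val_ofMem (h : IsLoopFolder H K) (x : G) (hx : x ∈ K) : val (h.ofMem x hx) = x := rfl

theorem rep_eq_ofMem (h : IsLoopFolder H K) {g x : G} (hx : x ∈ K) (hg : g * x⁻¹ ∈ H) :
    h.rep g = h.ofMem x hx := (h.rep_eq_iff _ _).2 hg

/-- Elements of the same coset of `H` have the same representative. -/
theorem rep_eq_rep (h : IsLoopFolder H K) {g g' : G} (hg : g * g'⁻¹ ∈ H) :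
    h.rep g = h.rep g' := by
  rw [rep_eq_iff]
  have h1 := (h.rep_eq_iff g' _).1 rfl
  simpa [mul_assoc] using H.mul_mem hg h1

theorem mul_inv_val_rep_mem (h : IsLoopFolder H K) (g : G) : g * (val (h.rep g))⁻¹ ∈ H :=
  (h.rep_eq_iff g _).1 rfl

/-- Right multiplication is well defined on the cosets `Hg`, so an inner representative may be
dropped. -/
theorem rep_val_rep_mul (h : IsLoopFolder H K) (g g' : G) :
    h.rep (val (h.rep g) * g') = h.rep (g * g') := by
  refine h.rep_eq_rep ?_
  have := H.inv_mem (h.mul_inv_val_rep_mem g)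
  convert this using 1; group

end IsLoopFolder

/-- As `y` is its own inverse, `yzy` is a conjugate of `z` and lies in `K`. Hence the loop product
`(y * z) * y` is the group element `yzy` itself, and both sides of the Bol identity represent the
coset of `xyzy`. -/
theorem isBolLoopFolder_of_conj_mem (h1 : 1 ∈ K) (hconj : ∀ g : G, ∀ x ∈ K, g * x * g⁻¹ ∈ K)
    (hc : Subgroup.IsComplement (H : Set G) K) (hsq : ∀ x ∈ K, x * x = 1)
    (hne : ∃ x ∈ K, x ≠ 1) : IsBolLoopFolder H K := by
  have h := isLoopFolder_of_conj_mem h1 hconj hc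
  refine ⟨h, fun x y z => ?_, fun x => ?_, ?_⟩
  · have hy : (IsLoopFolder.val y)⁻¹ = IsLoopFolder.val y :=
      inv_eq_of_mul_eq_one_left (hsq _ (IsLoopFolder.val_mem y))
    have hyz : IsLoopFolder.val y * IsLoopFolder.val z * IsLoopFolder.val y ∈ K := by
      have := hconj (IsLoopFolder.val y) _ (IsLoopFolder.val_mem z)
      rwa [hy] at this
    have e1 : y * z * y = h.ofMem _ hyz := by
      rw [h.mul_def, h.mul_def, h.rep_val_rep_mul, h.rep_eq_ofMem hyz (by simp)]
    rw [e1, h.mul_def, h.mul_def, h.mul_def x y, h.rep_val_rep_mul,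
      mul_assoc (IsLoopFolder.val (h.rep _)), h.rep_val_rep_mul, h.mul_def, h.val_ofMem]
    simp only [mul_assoc]
  · rw [h.mul_def, hsq _ (IsLoopFolder.val_mem x)]
    exact h.rep_val 1
  · obtain ⟨x, hx, hx1⟩ := hne
    exact ⟨h.ofMem x hx, fun h' => hx1 (congrArg IsLoopFolder.val h')⟩

theorem isOneUnionInvolutionClasses_of_conj_mem (h1 : 1 ∈ K)
    (hconj : ∀ g : G, ∀ x ∈ K, g * x * g⁻¹ ∈ K) (hsq : ∀ x ∈ K, x * x = 1) :
    IsOneUnionInvolutionClasses K := by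
  refine ⟨K \ {1}, fun t ht => orderOf_eq_prime (by rw [pow_two, hsq t ht.1]) ht.2, ?_⟩
  ext x
  simp only [Set.mem_union, Set.mem_singleton_iff, Set.mem_iUnion, conjugatesOf, Set.mem_ofPred_eq,
    exists_prop]
  constructor
  · intro hx
    by_cases hx1 : x = 1
    · exact Or.inl hx1
    · exact Or.inr ⟨x, ⟨hx, hx1⟩, IsConj.refl x⟩
  · rintro (rfl | ⟨t, ht, htx⟩)
    · exact h1
    · obtain ⟨g, rfl⟩ := isConj_iff.1 htx
      exact hconj g t ht.1

theorem isComplement_of_eq_of_card_le [Finite G]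
    (hinj : ∀ x ∈ K, ∀ y ∈ K, x * y⁻¹ ∈ H → x = y)
    (hcard : Nat.card G ≤ Nat.card H * Nat.card K) : Subgroup.IsComplement (H : Set G) K := by
  have hi : Function.Injective fun x : ↥(H : Set G) × ↥K => x.1.1 * x.2.1 := by
    rintro ⟨⟨h, hh⟩, ⟨x, hx⟩⟩ ⟨⟨h', hh'⟩, ⟨y, hy⟩⟩ he
    simp only at he
    have h1 : x * y⁻¹ = h⁻¹ * h' := by
      rw [mul_inv_eq_iff_eq_mul, mul_assoc, ← he, inv_mul_cancel_left]
    obtain rfl := hinj x hx y hy (h1 ▸ H.mul_mem (H.inv_mem hh) hh')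
    obtain rfl := mul_right_cancel he
    rfl
  exact hi.bijective_of_nat_card_le (by rw [Nat.card_prod]; exact hcard)

end Folder

/-! ### The module `J` as a permutation module on six points -/

section PointModule

open Equiv

variable {G : Type*} [Group G] (J : Subgroup G) [J.Normal] (e : G ⧸ J ≃* Perm (Fin 5))

/-- The homomorphism from `G` onto `S₅` with kernel `J`. -/
def toPerm : G →* Perm (Fin 5) := e.toMonoidHom.comp (QuotientGroup.mk' J)

theorem toPerm_surjective : Function.Surjective (toPerm J e) :=
  e.surjective.comp (QuotientGroup.mk'_surjective J)

theorem toPerm_eq_one {g : G} : toPerm J e g = 1 ↔ g ∈ J := by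
  rw [← QuotientGroup.eq_one_iff]
  exact e.map_eq_one_iff

theorem gRepU_apply (g : G) (u : UMod) : gRepU J e g u = repU (toPerm J e g) u := rfl

/-- `θ` induces an isomorphism of `G`-modules from the `𝔽₂`-permutation module on `X` modulo the
constant functions onto `J`. -/
structure IsPointModule (X : Type*) [MulAction (Perm (Fin 5)) X] (θ : (X → ZMod 2) → G) :
    Prop where
  map_add : ∀ v w, θ (v + w) = θ v * θ w
  mem_iff : ∀ j, j ∈ J ↔ ∃ v, θ v = j
  eq_one_iff : ∀ v, θ v = 1 ↔ ∃ a, v = fun _ => a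
  conj : ∀ g v, g * θ v * g⁻¹ = θ fun x => v ((toPerm J e g)⁻¹ • x)

theorem card_projectiveLine : Nat.card (ℙ (ZMod 5) (Fin 2 → ZMod 5)) = 6 := by
  rw [Projectivization.card'']
  simp

theorem exists_PGL_smul_eq (p q : ℙ (ZMod 5) (Fin 2 → ZMod 5)) :
    ∃ g : PGL(2, ZMod 5), g • p = q := by
  obtain ⟨s, hs⟩ := MulAction.exists_smul_eq (SL(2, ZMod 5)) p q
  refine ⟨Matrix.SpecialLinearGroup.toPGL s, ?_⟩
  rw [← hs]
  induction p using Projectivization.ind with | _ v hv =>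
  rfl

theorem mem_invariants_permRep {A X : Type*} [Group A] [MulAction A X]
    [MulAction.IsPretransitive A X] [Nonempty X] {v : X → ZMod 2} :
    v ∈ (permRep A X).invariants ↔ ∃ a, v = fun _ => a := by
  rw [Representation.mem_invariants]
  constructor
  · intro h
    obtain ⟨p⟩ := ‹Nonempty X›
    refine ⟨v p, funext fun q => ?_⟩
    obtain ⟨g, rfl⟩ := MulAction.exists_smul_eq A q p
    have := congrFun (h g⁻¹) q
    change v (g⁻¹⁻¹ • q) = v q at this
    rw [← this, inv_inv]
  · rintro ⟨a, rfl⟩ g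
    rfl

/-- The projective line becomes an `S₅`-set through `S₅ ≅ G/J ≅ PGL(2,5)`. The given isomorphism
with `S₅` is arbitrary, but only transitivity and the number of points are used afterwards. -/
theorem ConditionStar.exists_isPointModule {J : Subgroup G} [J.Normal] (hG : ConditionStar G J)
    (e : G ⧸ J ≃* Perm (Fin 5)) :
    ∃ (X : Type) (_ : MulAction (Perm (Fin 5)) X) (θ : (X → ZMod 2) → G),
      MulAction.IsPretransitive (Perm (Fin 5)) X ∧ Nat.card X = 6 ∧ IsPointModule J e X θ := by
  obtain ⟨φ, α, h⟩ := hG.perm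
  let X := ℙ (ZMod 5) (Fin 2 → ZMod 5)
  have hX : Nat.card X = 6 := card_projectiveLine
  have : Nonempty X := (Nat.card_pos_iff.1 (by omega)).1
  have hpre : MulAction.IsPretransitive PGL(2, ZMod 5) X := ⟨exists_PGL_smul_eq⟩
  let act : MulAction (Perm (Fin 5)) X :=
    MulAction.compHom X (φ.toMonoidHom.comp e.symm.toMonoidHom)
  have hact : ∀ (σ : Perm (Fin 5)) (p : X), σ • p = φ (e.symm σ) • p := fun _ _ => rfl
  refine ⟨X, act, fun v => ((α.symm (Submodule.mkQ _ v)).toMul : J), ⟨fun p q => ?_⟩, hX, ?_⟩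
  · obtain ⟨g, hg⟩ := exists_PGL_smul_eq p q
    exact ⟨e (φ.symm g), by rw [hact]; simpa using hg⟩
  · refine ⟨fun v w => ?_, fun j => ⟨fun hj => ?_, ?_⟩, fun v => ?_, fun g v => ?_⟩
    · rw [_root_.map_add, _root_.map_add]; rfl
    · obtain ⟨v, hv⟩ := Submodule.mkQ_surjective _ (α (Additive.ofMul ⟨j, hj⟩))
      exact ⟨v, by rw [hv, α.symm_apply_apply]; rfl⟩
    · rintro ⟨v, rfl⟩
      exact Subtype.property _
    · rw [← mem_invariants_permRep (A := PGL(2, ZMod 5)), ← Submodule.Quotient.mk_eq_zero,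
        ← Submodule.mkQ_apply, ← α.symm.map_eq_zero_iff, ← toMul_eq_one, Subtype.ext_iff]
      rfl
    · have h1 := h g (α.symm (Submodule.mkQ _ v)).toMul
      rw [ofMul_toMul, α.apply_symm_apply, ← α.eq_symm_apply] at h1
      have h2 := congrArg (fun j : Additive J => ((j.toMul : J) : G)) h1
      simp only [toMul_ofMul, MulAut.conjNormal_apply] at h2
      rw [h2]
      congr 3
      have h3 : ∀ p : X, (toPerm J e g)⁻¹ • p = (φ (QuotientGroup.mk g))⁻¹ • p := by
        intro p
        rw [hact, ← map_inv, ← map_inv]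
        congr 2
        exact e.symm_apply_apply _
      simp only [h3]
      rfl

end PointModule

/-! ### Weights, commutators and centralized elements in the module on six points. -/

section PointModule

open Equiv

variable {G : Type*} [Group G] {J : Subgroup G} [J.Normal] {e : G ⧸ J ≃* Perm (Fin 5)}

namespace IsPointModule

variable {X : Type*} [MulAction (Perm (Fin 5)) X] {θ : (X → ZMod 2) → G}

theorem mem (hθ : IsPointModule J e X θ) (v : X → ZMod 2) : θ v ∈ J := (hθ.mem_iff _).2 ⟨v, rfl⟩

theorem mul_self (hθ : IsPointModule J e X θ) (v : X → ZMod 2) : θ v * θ v = 1 := by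
  rw [← hθ.map_add, hθ.eq_one_iff]
  exact ⟨0, funext fun x => CharTwo.add_self_eq_zero _⟩

theorem inv_eq (hθ : IsPointModule J e X θ) (v : X → ZMod 2) : (θ v)⁻¹ = θ v :=
  inv_eq_of_mul_eq_one_left (hθ.mul_self v)

theorem eq_iff (hθ : IsPointModule J e X θ) (v w : X → ZMod 2) :
    θ v = θ w ↔ ∃ a, v + w = fun _ => a := by
  rw [← hθ.eq_one_iff, hθ.map_add, ← hθ.inv_eq w, mul_inv_eq_one, hθ.inv_eq w]

theorem map_zero (hθ : IsPointModule J e X θ) : θ 0 = 1 := (hθ.eq_one_iff 0).2 ⟨0, rfl⟩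

theorem comm (hθ : IsPointModule J e X θ) {x y : G} (hx : x ∈ J) (hy : y ∈ J) : x * y = y * x := by
  obtain ⟨v, rfl⟩ := (hθ.mem_iff x).1 hx
  obtain ⟨w, rfl⟩ := (hθ.mem_iff y).1 hy
  rw [← hθ.map_add, ← hθ.map_add, add_comm]

theorem map_sum (hθ : IsPointModule J e X θ) {S : Subgroup G} {ι : Type*} (s : Finset ι)
    (v : ι → X → ZMod 2) (h : ∀ i ∈ s, θ (v i) ∈ S) : θ (∑ i ∈ s, v i) ∈ S := by
  classical
  induction s using Finset.induction_on with
  | empty => rw [Finset.sum_empty, hθ.map_zero]; exact S.one_mem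
  | insert i s hi ih =>
    rw [Finset.sum_insert hi, hθ.map_add]
    exact S.mul_mem (h i (Finset.mem_insert_self i s))
      (ih fun j hj => h j (Finset.mem_insert_of_mem hj))

theorem conj_single (hθ : IsPointModule J e X θ) [DecidableEq X] (g : G) (p : X) :
    g * θ (Pi.single p 1) * g⁻¹ = θ (Pi.single (toPerm J e g • p) 1) := by
  rw [hθ.conj]
  congr 1
  funext q
  rw [Pi.single_apply, Pi.single_apply]
  simp only [inv_smul_eq_iff]

variable [Fintype X]

theorem sum_comp_smul (v : X → ZMod 2) (σ : Perm (Fin 5)) : ∑ x, v (σ • x) = ∑ x, v x :=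
  Equiv.sum_comp (MulAction.toPerm σ) v

/-- Commutators with `J` have the form `v^g + v` and so have even weight. Conversely, by
transitivity, the sums of two indicators are commutators, and they span the vectors of even weight.
-/
theorem mem_commutator_iff [MulAction.IsPretransitive (Perm (Fin 5)) X]
    (hθ : IsPointModule J e X θ) (hX : Nat.card X = 6) (v : X → ZMod 2) :
    θ v ∈ ⁅(⊤ : Subgroup G), J⁆ ↔ ∑ x, v x = 0 := by
  classical
  constructor
  · let S : Subgroup G :=
      { carrier := {x | ∃ v, ∑ x, v x = 0 ∧ θ v = x}
        one_mem' := ⟨0, by simp, hθ.map_zero⟩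
        mul_mem' := by
          rintro _ _ ⟨v, hv, rfl⟩ ⟨w, hw, rfl⟩
          exact ⟨v + w, by simp [Finset.sum_add_distrib, hv, hw], hθ.map_add v w⟩
        inv_mem' := by
          rintro _ ⟨v, hv, rfl⟩
          exact ⟨v, hv, (hθ.inv_eq v).symm⟩ }
    have hS : ⁅(⊤ : Subgroup G), J⁆ ≤ S := by
      rw [Subgroup.commutator_le]
      intro g _ j hj
      obtain ⟨w, rfl⟩ := (hθ.mem_iff j).1 hj
      refine ⟨(fun x => w ((toPerm J e g)⁻¹ • x)) + w, ?_, ?_⟩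
      · simp only [Pi.add_apply, Finset.sum_add_distrib, sum_comp_smul]
        exact CharTwo.add_self_eq_zero _
      · rw [hθ.map_add, ← hθ.conj, commutatorElement_def, hθ.inv_eq]
    intro hv
    obtain ⟨w, hw, hvw⟩ := hS hv
    obtain ⟨a, ha⟩ := (hθ.eq_iff w v).1 hvw
    -- The weight modulo `2` is well defined on the quotient because a constant function on six
    -- points has even weight.
    have h1 : ∑ x, (w + v) x = 0 := by
      rw [ha, Finset.sum_const, Finset.card_univ, ← Nat.card_eq_fintype_card, hX]
      generalize a = a
      revert a; decide
    simpa [Finset.sum_add_distrib, hw] using h1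
  · intro hv
    obtain ⟨p⟩ : Nonempty X := (Nat.card_pos_iff.1 (by omega)).1
    have hsingle : ∀ x, θ (Pi.single x 1 + Pi.single p 1) ∈ ⁅(⊤ : Subgroup G), J⁆ := by
      intro x
      obtain ⟨σ, hσ⟩ := MulAction.exists_smul_eq (Perm (Fin 5)) p x
      obtain ⟨g, rfl⟩ := toPerm_surjective J e σ
      have h1 := Subgroup.commutator_mem_commutator (Subgroup.mem_top g)
        (hθ.mem (Pi.single p 1))
      rw [commutatorElement_def, hθ.inv_eq, hθ.conj, ← hθ.map_add] at h1
      convert h1 using 3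
      funext q
      rw [Pi.single_apply, Pi.single_apply, ← hσ]
      simp only [inv_smul_eq_iff]
    have h2 : v = ∑ x, v x • ((Pi.single x 1 + Pi.single p 1 : X → ZMod 2)) := by
      simp only [smul_add, Finset.sum_add_distrib, ← Finset.sum_smul, hv, zero_smul, add_zero]
      funext q
      simp [Finset.sum_apply, Pi.single_apply]
    rw [h2]
    refine hθ.map_sum _ _ fun x _ => ?_
    have h01 : ∀ a : ZMod 2, a = 0 ∨ a = 1 := by decide
    rcases h01 (v x) with h | h
    · rw [h, zero_smul, hθ.map_zero]; exact Subgroup.one_mem _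
    · rw [h, one_smul]; exact hsingle x

theorem relIndex_commutator [MulAction.IsPretransitive (Perm (Fin 5)) X]
    (hθ : IsPointModule J e X θ) (hX : Nat.card X = 6) :
    ⁅(⊤ : Subgroup G), J⁆.relIndex J = 2 := by
  classical
  obtain ⟨p⟩ : Nonempty X := (Nat.card_pos_iff.1 (by omega)).1
  rw [Subgroup.relIndex, Subgroup.index_eq_two_iff]
  refine ⟨⟨θ (Pi.single p 1), hθ.mem _⟩, fun ⟨b, hb⟩ => ?_⟩
  obtain ⟨v, rfl⟩ := (hθ.mem_iff b).1 hb
  simp only [Subgroup.mem_subgroupOf, Subgroup.coe_mul, ← hθ.map_add, hθ.mem_commutator_iff hX,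
    Pi.add_apply, Finset.sum_add_distrib, Finset.sum_pi_single']
  simp only [Finset.mem_univ, if_true]
  generalize ∑ x, v x = a
  revert a; decide

/-- An element of `J` that is centralized by an element of order `5` modulo `J` is determined by
the fixed point of that element. -/
theorem eq_one_or_of_commute (hθ : IsPointModule J e X θ) [DecidableEq X] {x : G} {p : X}
    (hp : toPerm J e x • p = p)
    (htrans : ∀ q r : X, q ≠ p → r ≠ p → ∃ n : ℕ, toPerm J e x ^ n • q = r)
    {j : G} (hj : j ∈ J) (hxj : x * j * x⁻¹ = j) : j = 1 ∨ j = θ (Pi.single p 1) := by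
  obtain ⟨v, rfl⟩ := (hθ.mem_iff j).1 hj
  rw [hθ.conj, hθ.eq_iff] at hxj
  obtain ⟨a, ha⟩ := hxj
  have hp' : (toPerm J e x)⁻¹ • p = p := by rw [inv_smul_eq_iff, hp]
  -- Invariance holds a priori only up to a constant; evaluation at the fixed point `p` shows that
  -- the constant is zero.
  have ha0 : a = 0 := by
    have := congrFun ha p
    rw [Pi.add_apply, hp', CharTwo.add_self_eq_zero] at this
    exact this.symm
  have hv : ∀ q, v ((toPerm J e x)⁻¹ • q) = v q := fun q => by
    have := congrFun ha q
    rw [ha0] at this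
    exact CharTwo.add_eq_zero.1 this
  have hpow : ∀ (n : ℕ) q, v (toPerm J e x ^ n • q) = v q := by
    intro n q
    induction n with
    | zero => simp
    | succ n ih =>
      rw [← ih, ← hv, pow_succ', mul_smul, inv_smul_smul]
  have hc : ∀ q r, q ≠ p → r ≠ p → v q = v r := by
    intro q r hq hr
    obtain ⟨n, rfl⟩ := htrans q r hq hr
    exact (hpow n q).symm
  by_cases h : ∃ q, q ≠ p ∧ v q ≠ v p
  · right
    obtain ⟨q, hq, hqp⟩ := h
    refine (hθ.eq_iff _ _).2 ⟨v q, funext fun r => ?_⟩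
    by_cases hr : r = p
    · subst hr
      rw [Pi.add_apply, Pi.single_eq_same]
      generalize v r = a at *
      generalize v q = b at *
      revert a b; decide
    · rw [Pi.add_apply, Pi.single_eq_of_ne hr, add_zero, hc r q hr hq]
  · left
    push Not at h
    refine (hθ.eq_one_iff _).2 ⟨v p, funext fun r => ?_⟩
    by_cases hr : r = p
    · rw [hr]
    · exact h r hr

theorem single_injective (hθ : IsPointModule J e X θ) [DecidableEq X] (hX : Nat.card X = 6)
    {p q : X} (h : θ (Pi.single p 1) = θ (Pi.single q 1)) : p = q := by
  by_contra hpq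
  obtain ⟨r, hr⟩ : ∃ r, r ∉ ({p, q} : Finset X) := by
    by_contra! h'
    have : Fintype.card X ≤ 2 := by
      rw [← Finset.card_univ, ← Finset.eq_univ_iff_forall.2 h']
      exact Finset.card_le_two
    rw [← Nat.card_eq_fintype_card, hX] at this
    omega
  simp only [Finset.mem_insert, Finset.mem_singleton, not_or] at hr
  obtain ⟨a, ha⟩ := (hθ.eq_iff _ _).1 h
  have h1 := congrFun ha p
  have h2 := congrFun ha r
  rw [Pi.add_apply, Pi.single_eq_same, Pi.single_eq_of_ne hpq] at h1
  rw [Pi.add_apply, Pi.single_eq_of_ne hr.1, Pi.single_eq_of_ne hr.2] at h2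
  exact absurd (h1.trans h2.symm) (by decide)

theorem single_notMem_commutator [MulAction.IsPretransitive (Perm (Fin 5)) X]
    (hθ : IsPointModule J e X θ) [DecidableEq X]
    (hX : Nat.card X = 6) (p : X) : θ (Pi.single p 1) ∉ ⁅(⊤ : Subgroup G), J⁆ := by
  rw [hθ.mem_commutator_iff hX, Finset.sum_pi_single']
  simp

end IsPointModule

end PointModule

/-! ### Consequences of `[G,G]/[G,J] ≅ SL(2,5)`. -/

section ConditionStar

open Equiv

variable {G : Type*} [Group G] {J : Subgroup G} [J.Normal]

/-- A matrix of determinant `1` equal to its inverse equals its adjugate, which in odd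
characteristic forces it to be scalar. -/
theorem SL_two_five_mul_comm_of_sq_eq_one (s u : SL(2, ZMod 5)) (hs : s * s = 1) :
    s * u = u * s := by
  have h1 : s⁻¹ = s := inv_eq_of_mul_eq_one_left hs
  have h2 : (Matrix.adjugate (s : Matrix (Fin 2) (Fin 2) (ZMod 5))) = s := congrArg Subtype.val h1
  rw [Matrix.adjugate_fin_two] at h2
  have h00 := congrFun (congrFun h2 0) 0
  have h01 := congrFun (congrFun h2 0) 1
  have h10 := congrFun (congrFun h2 1) 0
  simp at h00 h01 h10
  have key : ∀ a : ZMod 5, -a = a → a = 0 := by decide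
  have h01' := key _ h01
  have h10' := key _ h10
  ext i j
  simp only [Matrix.SpecialLinearGroup.coe_mul, Matrix.mul_apply, Fin.sum_univ_two]
  fin_cases i <;> fin_cases j <;> simp [h01', h10', h00, mul_comm]

theorem ConditionStar.card_eq_3840 (hG : ConditionStar G J) (e : G ⧸ J ≃* Perm (Fin 5)) :
    Nat.card G = 3840 := by
  have h1 : J.index = 120 := by
    rw [Subgroup.index, Nat.card_congr e.toEquiv, Nat.card_eq_fintype_card, Fintype.card_perm]
    rfl
  rw [← J.card_mul_index, h1, hG.card_eq]

theorem map_commutator_toPerm (e : G ⧸ J ≃* Perm (Fin 5)) :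
    (commutator G).map (toPerm J e) = alternatingGroup (Fin 5) := by
  rw [commutator_def, Subgroup.map_commutator,
    Subgroup.map_top_of_surjective _ (toPerm_surjective J e), ← commutator_def]
  exact alternatingGroup.commutator_perm_eq (by simp)

theorem exists_commutator_toPerm_eq (e : G ⧸ J ≃* Perm (Fin 5)) {σ : Perm (Fin 5)}
    (hσ : σ.sign = 1) : ∃ u ∈ commutator G, toPerm J e u = σ := by
  have : σ ∈ (commutator G).map (toPerm J e) := by
    rw [map_commutator_toPerm]; exact Perm.mem_alternatingGroup.2 hσ
  exact this

/-- The involution of `SL(2,5)` is central, so an element of the commutator subgroup whose square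
lies in `[G, J]` lies in `J`. -/
theorem ConditionStar.mem_of_sq_mem (hG : ConditionStar G J) (e : G ⧸ J ≃* Perm (Fin 5)) {t : G}
    (ht : t ∈ commutator G) (ht2 : t * t ∈ ⁅(⊤ : Subgroup G), J⁆) : t ∈ J := by
  obtain ⟨ψ⟩ := hG.quot_iso
  rw [← toPerm_eq_one J e]
  refine eq_one_of_commute_even fun s hs => ?_
  obtain ⟨u, hu, rfl⟩ := exists_commutator_toPerm_eq e hs
  let t' : commutator G := ⟨t, ht⟩
  let u' : commutator G := ⟨u, hu⟩
  have h1 : ψ (t' : _ ⧸ _) * ψ (t' : _ ⧸ _) = 1 := by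
    rw [← map_mul, ← QuotientGroup.mk_mul, ψ.map_eq_one_iff, QuotientGroup.eq_one_iff]
    exact ht2
  have h2 := SL_two_five_mul_comm_of_sq_eq_one _ (ψ (u' : _ ⧸ _)) h1
  rw [← map_mul, ← map_mul, ψ.injective.eq_iff, ← QuotientGroup.mk_mul, ← QuotientGroup.mk_mul,
    QuotientGroup.eq, Subgroup.mem_subgroupOf] at h2
  have h3 : (t * u)⁻¹ * (u * t) ∈ J := Subgroup.commutator_le_right _ _ h2
  rw [← toPerm_eq_one J e, map_mul, map_inv, inv_mul_eq_one, map_mul, map_mul] at h3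
  exact h3.symm

theorem isSwap_toPerm (e : G ⧸ J ≃* Perm (Fin 5)) {c : G} (hc : orderOf c = 2)
    (hcG : c ∉ commutator G ⊔ J) : (toPerm J e c).IsSwap := by
  refine isSwap_of_sign_of_sq (fun h => hcG ?_) ?_
  · obtain ⟨u, hu, huc⟩ := exists_commutator_toPerm_eq e h
    have h1 : u⁻¹ * c ∈ J := by
      rw [← toPerm_eq_one J e, map_mul, map_inv, huc, inv_mul_cancel]
    rw [← mul_inv_cancel_left u c]
    exact Subgroup.mul_mem_sup hu h1
  · rw [← map_pow, ← hc, pow_orderOf_eq_one, map_one]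

end ConditionStar

/-! ### The normalizer of a Sylow `5`-subgroup -/

section SylowNormalizer

open Equiv

variable {G : Type*} [Group G] {J : Subgroup G} [J.Normal]

namespace ConditionStar

theorem finite (hG : ConditionStar G J) (e : G ⧸ J ≃* Perm (Fin 5)) : Finite G :=
  Nat.finite_of_card_ne_zero (by rw [hG.card_eq_3840 e]; norm_num)

theorem exists_generator (hG : ConditionStar G J) (e : G ⧸ J ≃* Perm (Fin 5)) (P : Sylow 5 G) :
    ∃ x : G, (P : Subgroup G) = Subgroup.zpowers x ∧ orderOf x = 5 := by
  have := hG.finite e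
  have hP : Nat.card P = 5 := by
    rw [P.card_eq_multiplicity, hG.card_eq_3840 e,
      show 3840 = 5 * 768 by norm_num, Nat.factorization_mul (by norm_num) (by norm_num),
      Finsupp.add_apply, Nat.Prime.factorization_self (by norm_num),
      Nat.factorization_eq_zero_of_not_dvd (by norm_num)]
    norm_num
  have : IsCyclic P := isCyclic_of_prime_card (p := 5) hP
  obtain ⟨⟨x, hx⟩, hgen⟩ := IsCyclic.exists_generator (α := P)
  have heq : (P : Subgroup G) = Subgroup.zpowers x := by
    refine le_antisymm (fun y hy => ?_) (Subgroup.zpowers_le.2 hx)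
    obtain ⟨n, hn⟩ := hgen ⟨y, hy⟩
    exact ⟨n, congrArg Subtype.val hn⟩
  refine ⟨x, heq, ?_⟩
  rw [← Nat.card_zpowers, ← heq]
  exact hP

theorem orderOf_toPerm (hG : ConditionStar G J) (e : G ⧸ J ≃* Perm (Fin 5)) {x : G}
    (hx : orderOf x = 5) : orderOf (toPerm J e x) = 5 := by
  have hpow : x ^ 5 = 1 := orderOf_dvd_iff_pow_eq_one.1 (dvd_of_eq hx)
  refine orderOf_eq_prime (by rw [← map_pow, hpow, map_one]) fun h => ?_
  have h2 := orderOf_dvd_of_pow_eq_one (hG.sq_eq_one x ((toPerm_eq_one J e).1 h))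
  rw [hx] at h2
  norm_num at h2

theorem eq_one_of_mem_zpowers (hG : ConditionStar G J) {x j : G} (hx : orderOf x = 5)
    (hj : j ∈ J) (hjx : j ∈ Subgroup.zpowers x) : j = 1 := by
  have h1 : orderOf j ∣ 5 := by
    rw [← hx]; exact orderOf_dvd_of_mem_zpowers hjx
  have h2 : orderOf j ∣ 2 := orderOf_dvd_of_pow_eq_one (hG.sq_eq_one j hj)
  have h3 := Nat.dvd_gcd h1 h2
  rw [show Nat.gcd 5 2 = 1 by norm_num, Nat.dvd_one, orderOf_eq_one_iff] at h3
  exact h3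

end ConditionStar

theorem toPerm_mem_of_mem_normalizer (e : G ⧸ J ≃* Perm (Fin 5)) {P : Sylow 5 G} {x : G}
    (hP : (P : Subgroup G) = Subgroup.zpowers x) {h : G}
    (hh : h ∈ Subgroup.normalizer (P : Set G)) :
    toPerm J e h * toPerm J e x * (toPerm J e h)⁻¹ ∈ Subgroup.zpowers (toPerm J e x) := by
  have h1 : x ∈ (P : Subgroup G) := hP ▸ Subgroup.mem_zpowers x
  have h2 : h * x * h⁻¹ ∈ (P : Subgroup G) := (Subgroup.mem_normalizer_iff.1 hh x).1 h1
  rw [hP] at h2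
  have h3 := Subgroup.mem_map_of_mem (toPerm J e) h2
  rwa [MonoidHom.map_zpowers, map_mul, map_mul, map_inv] at h3

/-- The normalizer of `P` maps onto the normalizer of the image of `P`. -/
theorem ConditionStar.exists_normalizer_toPerm_eq (hG : ConditionStar G J)
    (e : G ⧸ J ≃* Perm (Fin 5)) {P : Sylow 5 G} {x : G}
    (hP : (P : Subgroup G) = Subgroup.zpowers x) {τ : Perm (Fin 5)}
    (hτ : τ * toPerm J e x * τ⁻¹ ∈ Subgroup.zpowers (toPerm J e x)) :
    ∃ h ∈ Subgroup.normalizer (P : Set G), toPerm J e h = τ := by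
  have := hG.finite e
  obtain ⟨g, rfl⟩ := toPerm_surjective J e τ
  let M : Subgroup G := (Subgroup.zpowers (toPerm J e x)).comap (toPerm J e)
  have h1 : (P : Subgroup G) ≤ M := by
    rw [hP, Subgroup.zpowers_le]
    exact Subgroup.mem_zpowers _
  have h2 : ((g • P : Sylow 5 G) : Subgroup G) ≤ M := by
    rintro _ ⟨y, hy, rfl⟩
    have hy' : y ∈ Subgroup.zpowers x := hP ▸ hy
    obtain ⟨n, rfl⟩ := hy'
    change toPerm J e (g * x ^ n * g⁻¹) ∈ Subgroup.zpowers (toPerm J e x)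
    rw [map_mul, map_mul, map_inv, map_zpow, ← conj_zpow]
    exact Subgroup.zpow_mem _ hτ n
  -- Frattini argument: `P` and its conjugate by `g` are Sylow subgroups of the preimage `M` of the
  -- image of `P`, hence conjugate in `M`. So `m * g` normalizes `P`; the image of `m` is a power of
  -- that of `x`, which is then divided out.
  obtain ⟨m, hm⟩ := MulAction.exists_smul_eq M ((g • P).subtype h2) (P.subtype h1)
  simp_rw [Sylow.smul_subtype, Subgroup.smul_def, smul_smul] at hm
  have h3 := Sylow.smul_eq_iff_mem_normalizer.mp (Sylow.subtype_injective hm)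
  obtain ⟨n, hn⟩ := m.2
  have hxn : x ^ n ∈ Subgroup.normalizer (P : Set G) :=
    Subgroup.le_normalizer (H := (P : Subgroup G)) (hP ▸ Subgroup.zpow_mem_zpowers x n)
  refine ⟨(x ^ n)⁻¹ * (m * g), Subgroup.mul_mem _ (Subgroup.inv_mem _ hxn) h3, ?_⟩
  simp only at hn
  rw [map_mul, map_mul, map_inv, map_zpow, hn, inv_mul_cancel_left]

namespace ConditionStar

/-- The normalizer of `P` contains elements acting as conjugates of `rot` and `dbl`. -/
theorem exists_normalizer_rot_dbl (hG : ConditionStar G J) (e : G ⧸ J ≃* Perm (Fin 5))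
    (P : Sylow 5 G) :
    ∃ π : Perm (Fin 5), (∃ h ∈ Subgroup.normalizer (P : Set G), toPerm J e h = π * rot * π⁻¹) ∧
      ∃ h ∈ Subgroup.normalizer (P : Set G), toPerm J e h = π * dbl * π⁻¹ := by
  obtain ⟨x, hP, hx⟩ := hG.exists_generator e P
  obtain ⟨π, hπ⟩ := exists_conj_rot (hG.orderOf_toPerm e hx)
  refine ⟨π, hG.exists_normalizer_toPerm_eq e hP ?_, hG.exists_normalizer_toPerm_eq e hP ?_⟩
  · rw [hπ, mul_inv_cancel_right]
    exact Subgroup.mem_zpowers _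
  · rw [hπ]
    have h1 : π * dbl * π⁻¹ * (π * rot * π⁻¹) * (π * dbl * π⁻¹)⁻¹ =
        π * (dbl * rot * dbl⁻¹) * π⁻¹ := by group
    rw [h1, conj_mem_zpowers_conj, dbl_mul_rot]
    exact Subgroup.npow_mem_zpowers _ _

/-- The commutator of `j` and `x` lies in both `J` and `P`, which meet trivially. -/
theorem conj_eq_of_mem_normalizer (hG : ConditionStar G J) {P : Sylow 5 G} {x : G}
    (hP : (P : Subgroup G) = Subgroup.zpowers x) (hx : orderOf x = 5) {j : G} (hj : j ∈ J)
    (hjP : j ∈ Subgroup.normalizer (P : Set G)) : x * j * x⁻¹ = j := by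
  have h1 : x ∈ (P : Subgroup G) := hP ▸ Subgroup.mem_zpowers x
  have h2 : j * x * j⁻¹ ∈ (P : Subgroup G) := (Subgroup.mem_normalizer_iff.1 hjP x).1 h1
  have h3 : j * x * j⁻¹ * x⁻¹ ∈ (P : Subgroup G) := mul_mem h2 (inv_mem h1)
  have h4 : j * x * j⁻¹ * x⁻¹ ∈ J := by
    have : j * (x * j⁻¹ * x⁻¹) ∈ J :=
      J.mul_mem hj (Subgroup.Normal.conj_mem inferInstance _ (J.inv_mem hj) x)
    simpa only [mul_assoc] using this
  rw [hP] at h3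
  have h5 := hG.eq_one_of_mem_zpowers hx h4 h3
  rw [mul_inv_eq_one, mul_inv_eq_iff_eq_mul] at h5
  rw [← h5, mul_inv_cancel_right]

/-- The intersection of `J` with the normalizer of `P` is not trivial, meets `[G, J]` trivially, and
none of its nontrivial elements is centralized by an element acting as a transposition. -/
theorem normalizer_inf (hG : ConditionStar G J) (e : G ⧸ J ≃* Perm (Fin 5)) (P : Sylow 5 G) :
    (∃ z ∈ Subgroup.normalizer (P : Set G), z ∈ J ∧ z ≠ 1) ∧
    (∀ j ∈ Subgroup.normalizer (P : Set G), j ∈ ⁅(⊤ : Subgroup G), J⁆ → j = 1) ∧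
    ∀ j ∈ Subgroup.normalizer (P : Set G), j ∈ J → ∀ c : G, (toPerm J e c).IsSwap →
      c * j * c⁻¹ = j → j = 1 := by
  classical
  obtain ⟨x, hP, hx⟩ := hG.exists_generator e P
  obtain ⟨X, act, θ, htr, hX, hθ⟩ := hG.exists_isPointModule e
  have : Finite X := Nat.finite_of_card_ne_zero (by omega)
  have : Fintype X := Fintype.ofFinite X
  obtain ⟨p, hp, hpt⟩ := exists_fixedPoint_of_orderOf_eq_five hX (hG.orderOf_toPerm e hx)
  have key : ∀ j ∈ Subgroup.normalizer (P : Set G), j ∈ J → j = 1 ∨ j = θ (Pi.single p 1) :=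
    fun j hjP hj => hθ.eq_one_or_of_commute hp hpt hj (hG.conj_eq_of_mem_normalizer hP hx hj hjP)
  have hz := hθ.single_notMem_commutator hX p
  refine ⟨⟨θ (Pi.single p 1), ?_, hθ.mem _, fun h => hz (h ▸ Subgroup.one_mem _)⟩, ?_, ?_⟩
  · have hcomm : x * θ (Pi.single p 1) = θ (Pi.single p 1) * x := by
      have := hθ.conj_single x p
      rw [hp, mul_inv_eq_iff_eq_mul] at this
      exact this
    refine Subgroup.centralizer_le_normalizer (s := (P : Set G)) ?_
    rw [Subgroup.mem_centralizer_iff]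
    intro y hy
    have hy' : y ∈ Subgroup.zpowers x := hP ▸ hy
    obtain ⟨n, rfl⟩ := hy'
    exact (Commute.zpow_left hcomm n)
  · intro j hjP hj
    refine (key j hjP (Subgroup.commutator_le_right _ _ hj)).resolve_right fun h => hz (h ▸ hj)
  · intro j hjP hj c hc hcj
    refine (key j hjP hj).resolve_right fun h => ?_
    rw [h, hθ.conj_single] at hcj
    exact isSwap_smul_ne hX hc p (hθ.single_injective hX hcj)

theorem forty_le_card_normalizer (hG : ConditionStar G J) (e : G ⧸ J ≃* Perm (Fin 5))
    (P : Sylow 5 G) : 40 ≤ Nat.card (Subgroup.normalizer (P : Set G)) := by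
  have := hG.finite e
  obtain ⟨π, ⟨h₁, hh₁, h₁π⟩, ⟨h₂, hh₂, h₂π⟩⟩ := hG.exists_normalizer_rot_dbl e P
  obtain ⟨⟨z, hzP, hzJ, hz1⟩, -, -⟩ := hG.normalizer_inf e P
  let H := Subgroup.normalizer (P : Set G)
  let f : H →* Perm (Fin 5) := (toPerm J e).comp H.subtype
  have hr5 : 5 ∣ Nat.card f.range := by
    have h1 : π * rot * π⁻¹ ∈ f.range := ⟨⟨h₁, hh₁⟩, h₁π⟩
    have h2 : orderOf (π * rot * π⁻¹) = 5 := ((MulAut.conj π).orderOf_eq rot).trans orderOf_rot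
    have h3 := orderOf_dvd_natCard (⟨_, h1⟩ : f.range)
    rwa [Subgroup.orderOf_mk, h2] at h3
  have hr4 : 4 ∣ Nat.card f.range := by
    have h1 : π * dbl * π⁻¹ ∈ f.range := ⟨⟨h₂, hh₂⟩, h₂π⟩
    have h2 : orderOf (π * dbl * π⁻¹) = 4 := ((MulAut.conj π).orderOf_eq dbl).trans
      (orderOf_eq_prime_pow (p := 2) (n := 1) (by decide) (by decide))
    have h3 := orderOf_dvd_natCard (⟨_, h1⟩ : f.range)
    rwa [Subgroup.orderOf_mk, h2] at h3
  have hr : 20 ≤ Nat.card f.range :=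
    Nat.le_of_dvd Nat.card_pos (Nat.Coprime.mul_dvd_of_dvd_of_dvd (by norm_num) hr4 hr5)
  have hk : 2 ≤ Nat.card f.ker := by
    have : Nontrivial f.ker := ⟨⟨⟨⟨z, hzP⟩, (toPerm_eq_one J e).2 hzJ⟩, 1, fun h =>
      hz1 (congrArg (fun k : f.ker => ((k : H) : G)) h)⟩⟩
    exact Finite.one_lt_card
  rw [← f.ker.card_mul_index, Subgroup.index_ker]
  exact Nat.mul_le_mul hk hr

end ConditionStar

end SylowNormalizer

/-! ### The folder `(G, H, K)` -/

section SmallFolder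

open Equiv

variable {G : Type*} [Group G] {J : Subgroup G} {c : G}

theorem mem_smallK {x : G} : x ∈ smallK J c ↔ x ∈ ⁅(⊤ : Subgroup G), J⁆ ∨ IsConj c x := Iff.rfl

variable [J.Normal]

theorem conj_mem_smallK (g : G) {x : G} (hx : x ∈ smallK J c) : g * x * g⁻¹ ∈ smallK J c := by
  rw [mem_smallK] at hx ⊢
  refine hx.imp (fun h => Subgroup.Normal.conj_mem inferInstance _ h g) fun h => ?_
  exact h.trans (isConj_iff.2 ⟨g, rfl⟩)

theorem mul_self_eq_one_of_isConj (hc : orderOf c = 2) {x : G} (hx : IsConj c x) : x * x = 1 := by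
  obtain ⟨g, rfl⟩ := isConj_iff.1 hx
  have h : c * c = 1 := by rw [← pow_two, ← hc, pow_orderOf_eq_one]
  have h2 : g * c * g⁻¹ * (g * c * g⁻¹) = g * (c * c) * g⁻¹ := by group
  rw [h2, h, mul_one, mul_inv_cancel]

theorem isSwap_toPerm_of_isConj (e : G ⧸ J ≃* Perm (Fin 5)) (hc : (toPerm J e c).IsSwap) {x : G}
    (hx : IsConj c x) : (toPerm J e x).IsSwap := by
  obtain ⟨g, rfl⟩ := isConj_iff.1 hx
  rw [map_mul, map_mul, map_inv]
  exact isSwap_conj hc _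

theorem exists_isConj_toPerm_eq (e : G ⧸ J ≃* Perm (Fin 5)) (hc : (toPerm J e c).IsSwap)
    {σ : Perm (Fin 5)} (hσ : σ.IsSwap) : ∃ x, IsConj c x ∧ toPerm J e x = σ := by
  obtain ⟨a, b, hab, hc⟩ := hc
  obtain ⟨a', b', hab', rfl⟩ := hσ
  obtain ⟨τ, hτ⟩ := isConj_iff.1 (Perm.isConj_swap hab hab')
  obtain ⟨g, rfl⟩ := toPerm_surjective J e τ
  exact ⟨g * c * g⁻¹, isConj_iff.2 ⟨g, rfl⟩, by rw [map_mul, map_mul, map_inv, hc, hτ]⟩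

/-- The product of two conjugate involutions is a commutator. -/
theorem mul_mem_commutator_of_isConj (hc : orderOf c = 2) {x y : G} (hx : IsConj c x)
    (hy : IsConj c y) : x * y ∈ commutator G := by
  obtain ⟨g, rfl⟩ := isConj_iff.1 (hx.symm.trans hy)
  have hx2 : x⁻¹ = x := inv_eq_of_mul_eq_one_left (mul_self_eq_one_of_isConj hc hx)
  have h := Subgroup.commutator_mem_commutator (Subgroup.mem_top x) (Subgroup.mem_top g)
  rw [commutatorElement_def, hx2, ← commutator_def] at h
  simpa only [mul_assoc] using h

theorem toPerm_eq_one_of_mem_commutator (e : G ⧸ J ≃* Perm (Fin 5)) {x : G}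
    (hx : x ∈ ⁅(⊤ : Subgroup G), J⁆) : toPerm J e x = 1 :=
  (toPerm_eq_one J e).2 (Subgroup.commutator_le_right _ _ hx)

theorem exists_finset_isSwap :
    ∃ B : Finset (Perm (Fin 5)), B.card = 10 ∧ ∀ σ ∈ B, σ.IsSwap := by
  let A : Finset (Fin 5 × Fin 5) := Finset.univ.filter fun p => p.1 < p.2
  refine ⟨A.image fun p => swap p.1 p.2, ?_, fun σ hσ => ?_⟩
  · rw [Finset.card_image_of_injOn]
    · decide
    · have key : ∀ i j k l : Fin 5, i < j → k < l → swap i j = swap k l → i = k ∧ j = l := by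
        decide
      intro p hp q hq h
      obtain ⟨h1, h2⟩ := key _ _ _ _ (Finset.mem_filter.1 hp).2 (Finset.mem_filter.1 hq).2 h
      exact Prod.ext h1 h2
  · obtain ⟨p, hp, rfl⟩ := Finset.mem_image.1 hσ
    exact ⟨p.1, p.2, (Finset.mem_filter.1 hp).2.ne, rfl⟩

namespace ConditionStar

/-- Two elements of `J₀` are separated because `H` meets `J₀` trivially, and mixed pairs because a
transposition normalizes no group of order `5`. For two conjugates of `c`, the product `xy` is
inverted by `x`; once it or its square lies in `J`, being inverted means being centralized, and no
nontrivial element of `H ∩ J` is centralized by `x`. -/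
theorem eq_of_mul_inv_mem_normalizer (hG : ConditionStar G J) (e : G ⧸ J ≃* Perm (Fin 5))
    (P : Sylow 5 G) (hc : orderOf c = 2) (hcs : (toPerm J e c).IsSwap) {x y : G}
    (hx : x ∈ smallK J c) (hy : y ∈ smallK J c)
    (hxy : x * y⁻¹ ∈ Subgroup.normalizer (P : Set G)) : x = y := by
  obtain ⟨-, hJ0, hJ⟩ := hG.normalizer_inf e P
  obtain ⟨g, hP, hg⟩ := hG.exists_generator e P
  have hg5 := hG.orderOf_toPerm e hg
  have hH := toPerm_mem_of_mem_normalizer e hP hxy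
  rw [map_mul, map_inv] at hH
  rcases hx with hx | hx <;> rcases hy with hy | hy
  · exact mul_inv_eq_one.1 (hJ0 _ hxy (Subgroup.mul_mem _ hx (Subgroup.inv_mem _ hy)))
  · rw [toPerm_eq_one_of_mem_commutator e hx, one_mul, ← map_inv,
      inv_eq_of_mul_eq_one_left (mul_self_eq_one_of_isConj hc hy)] at hH
    exact absurd hH (isSwap_conj_notMem_zpowers (isSwap_toPerm_of_isConj e hcs hy) hg5)
  · rw [toPerm_eq_one_of_mem_commutator e hy, inv_one, mul_one] at hH
    exact absurd hH (isSwap_conj_notMem_zpowers (isSwap_toPerm_of_isConj e hcs hx) hg5)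
  · have hxs := isSwap_toPerm_of_isConj e hcs hx
    have hx2 : x⁻¹ = x := inv_eq_of_mul_eq_one_left (mul_self_eq_one_of_isConj hc hx)
    have hy2 : y⁻¹ = y := inv_eq_of_mul_eq_one_left (mul_self_eq_one_of_isConj hc hy)
    rw [← map_inv, hy2] at hH
    rw [hy2] at hxy
    have h1 := isSwap_mul_isSwap_sq hxs (isSwap_toPerm_of_isConj e hcs hy) hg5 hH
    rw [← map_mul, ← map_mul, toPerm_eq_one] at h1
    have hinv : x * (x * y) * x⁻¹ = (x * y)⁻¹ := by
      rw [mul_inv_rev, hx2, hy2, ← mul_assoc, mul_self_eq_one_of_isConj hc hx, one_mul]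
    have hself : ∀ j ∈ J, j⁻¹ = j := fun j hj =>
      inv_eq_of_mul_eq_one_left (by rw [← pow_two]; exact hG.sq_eq_one j hj)
    have h2 : x * y * (x * y) = 1 := by
      refine hJ _ (Subgroup.mul_mem _ hxy hxy) h1 x hxs ?_
      rw [← conj_mul, hinv, ← mul_inv_rev, hself _ h1]
    -- This step excludes double transpositions: `xy` now has square `1` in `[G,G]`, so its image in
    -- `SL(2,5)` is central.
    have h3 : x * y ∈ J := hG.mem_of_sq_mem e (mul_mem_commutator_of_isConj hc hx hy)
      (by rw [h2]; exact Subgroup.one_mem _)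
    have h4 := hJ _ hxy h3 x hxs (by rw [hinv, hself _ h3])
    rw [← hy2, mul_inv_eq_one] at h4
    exact h4

theorem card_commutator (hG : ConditionStar G J) (e : G ⧸ J ≃* Perm (Fin 5)) :
    Nat.card (⁅(⊤ : Subgroup G), J⁆ : Subgroup G) = 16 := by
  obtain ⟨X, act, θ, htr, hX, hθ⟩ := hG.exists_isPointModule e
  have : Finite X := Nat.finite_of_card_ne_zero (by omega)
  have : Fintype X := Fintype.ofFinite X
  have h1 := (⁅(⊤ : Subgroup G), J⁆.subgroupOf J).card_mul_index
  have h2 : (⁅(⊤ : Subgroup G), J⁆.subgroupOf J).index = 2 := hθ.relIndex_commutator hX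
  rw [h2, hG.card_eq,
    Nat.card_congr (Subgroup.subgroupOfEquivOfLe (Subgroup.commutator_le_right _ _)).toEquiv] at h1
  omega

/-- An involution that acts as a transposition is conjugate to its product with some element of
`J` outside `[G, J]`. -/
theorem exists_isConj_mul (hG : ConditionStar G J) (e : G ⧸ J ≃* Perm (Fin 5))
    (hc : orderOf c = 2) (hcs : (toPerm J e c).IsSwap) :
    ∃ s ∈ J, s ∉ ⁅(⊤ : Subgroup G), J⁆ ∧ IsConj c (c * s) := by
  obtain ⟨a, b, hab, hσ⟩ := hcs
  -- The second transposition is disjoint from the first. With `d` a conjugate of `c` above it, the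
  -- witness is `s = (cd)²`, because `d` conjugates `c` to `c(cd)²`; if `s` were in `J₀`, then `cd`
  -- would be in `J`.
  obtain ⟨i, j, hij, hsw⟩ : ∃ i j : Fin 5, i ≠ j ∧
      (swap a b * swap i j) * (swap a b * swap i j) = 1 ∧ swap a b * swap i j ≠ 1 := by
    have key : ∀ a b : Fin 5, a ≠ b → ∃ i j : Fin 5, i ≠ j ∧
        (swap a b * swap i j) * (swap a b * swap i j) = 1 ∧ swap a b * swap i j ≠ 1 := by decide
    exact key a b hab
  obtain ⟨d, hd, hdσ⟩ := exists_isConj_toPerm_eq e (c := c) ⟨a, b, hab, hσ⟩ ⟨i, j, hij, rfl⟩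
  have hc2 : c * c = 1 := mul_self_eq_one_of_isConj hc (IsConj.refl c)
  have hd2 : d⁻¹ = d := inv_eq_of_mul_eq_one_left (mul_self_eq_one_of_isConj hc hd)
  have hcd : toPerm J e (c * d) = swap a b * swap i j := by rw [map_mul, hσ, hdσ]
  refine ⟨c * d * (c * d), ?_, fun h => ?_, isConj_iff.2 ⟨d, ?_⟩⟩
  · rw [← toPerm_eq_one J e, map_mul, hcd, hsw.1]
  · refine hsw.2 ?_
    rw [← hcd, toPerm_eq_one]
    exact hG.mem_of_sq_mem e (mul_mem_commutator_of_isConj hc (IsConj.refl c) hd) h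
  · rw [hd2, ← mul_assoc c, ← mul_assoc c, hc2, one_mul, mul_assoc]

/-- Conjugation by `J` multiplies `c` by elements of `[c,J]`. As `c` acts on the six points as three
`2`-cycles, four such elements arise from functions supported on `a` and `b` in different cycles.
They all lie in `J₀`, so the factor `s` outside `J₀` doubles their number. -/
theorem eight_le_ncard_fiber (hG : ConditionStar G J) (e : G ⧸ J ≃* Perm (Fin 5))
    (hc : orderOf c = 2) (hcs : (toPerm J e c).IsSwap) :
    8 ≤ {x : G | IsConj c x ∧ toPerm J e x = toPerm J e c}.ncard := by
  classical
  have := hG.finite e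
  obtain ⟨X, act, θ, htr, hX, hθ⟩ := hG.exists_isPointModule e
  have : Finite X := Nat.finite_of_card_ne_zero (by omega)
  have : Fintype X := Fintype.ofFinite X
  obtain ⟨s, hs, hs', hcs'⟩ := hG.exists_isConj_mul e hc hcs
  have hc2 : c * c = 1 := mul_self_eq_one_of_isConj hc (IsConj.refl c)
  have hcinv : c⁻¹ = c := inv_eq_of_mul_eq_one_left hc2
  set σ := toPerm J e c with hσ
  have hσ2 : ∀ x : X, σ • σ • x = x := fun x => by
    rw [← mul_smul, mul_self_of_isSwap hcs, one_smul]
  have hσinv : σ⁻¹ = σ := inv_eq_of_mul_eq_one_left (mul_self_of_isSwap hcs)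
  have hcard : ∀ S : Finset X, S.card < 6 → ∃ x, x ∉ S := by
    intro S hS
    by_contra! h
    rw [Finset.eq_univ_iff_forall.2 h, Finset.card_univ, ← Nat.card_eq_fintype_card, hX] at hS
    omega
  obtain ⟨a, -⟩ := hcard ∅ (by simp)
  obtain ⟨b, hb⟩ := hcard {a, σ • a} (Finset.card_le_two.trans_lt (by norm_num))
  -- The point `q` lies in the third cycle, where all the functions `w (v r)` vanish; it detects the
  -- constant by which two of them could differ.
  obtain ⟨q, hq⟩ := hcard {a, σ • a, b, σ • b} (Finset.card_le_four.trans_lt (by norm_num))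
  simp only [Finset.mem_insert, Finset.mem_singleton, not_or] at hb hq
  have ha := isSwap_smul_ne hX hcs a
  have hb' := isSwap_smul_ne hX hcs b
  have hab : σ • b ≠ a := fun h => hb.2 (by rw [← h, hσ2])
  have hab' : σ • b ≠ σ • a := fun h => hb.1 (smul_left_cancel σ h)
  let w : (X → ZMod 2) → X → ZMod 2 := fun v x => v (σ⁻¹ • x) + v x
  let v : ZMod 2 × ZMod 2 → X → ZMod 2 := fun r => Pi.single a r.1 + Pi.single b r.2
  have hconj : ∀ v t, t ∈ J → θ v * (c * t) * (θ v)⁻¹ = c * (θ (w v) * t) := by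
    intro v t ht
    have h1 : θ (w v) = c * θ v * c⁻¹ * θ v := by
      rw [hθ.conj, ← hθ.map_add]; rfl
    rw [h1, hcinv, hθ.inv_eq, ← mul_assoc c, ← mul_assoc c, ← mul_assoc c, ← mul_assoc c, hc2,
      one_mul, mul_assoc, mul_assoc c, hθ.comm ht (hθ.mem v)]
    simp only [mul_assoc]
  let f : (ZMod 2 × ZMod 2) × Bool → G := fun r => c * (θ (w (v r.1)) * if r.2 then s else 1)
  have hf : ∀ r, f r ∈ {x : G | IsConj c x ∧ toPerm J e x = σ} := by
    rintro ⟨r, k⟩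
    have hk : (if k then s else 1) ∈ J := by
      split_ifs
      exacts [hs, J.one_mem]
    refine ⟨?_, ?_⟩
    · have h1 : IsConj c (c * if k then s else 1) := by
        split_ifs
        · exact hcs'
        · rw [mul_one]
      exact h1.trans (isConj_iff.2 ⟨θ (v r), hconj _ _ hk⟩)
    · change toPerm J e (c * (θ (w (v r)) * if k then s else 1)) = σ
      rw [map_mul, (toPerm_eq_one J e).2 (J.mul_mem (hθ.mem _) hk), mul_one]
  have hw0 : ∀ v, θ (w v) ∈ ⁅(⊤ : Subgroup G), J⁆ := by
    intro v
    rw [hθ.mem_commutator_iff hX, Finset.sum_add_distrib, IsPointModule.sum_comp_smul]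
    exact CharTwo.add_self_eq_zero _
  have hwa : ∀ r, w (v r) a = r.1 := by
    intro r
    simp [w, v, hσinv, ha, Ne.symm hb.1, Ne.symm hb.2]
  have hwb : ∀ r, w (v r) b = r.2 := by
    intro r
    simp [w, v, hσinv, hab, hb', hb]
  have hwq : ∀ r, w (v r) q = 0 := by
    intro r
    have h1 : σ • q ≠ a := fun h => hq.2.1 (by rw [← h, hσ2])
    have h2 : σ • q ≠ b := fun h => hq.2.2.2 (by rw [← h, hσ2])
    simp [w, v, hσinv, h1, h2, hq]
  have hinj : Function.Injective f := by
    rintro ⟨r, k⟩ ⟨r', k'⟩ h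
    have h1 : θ (w (v r)) * (if k then s else 1) = θ (w (v r')) * if k' then s else 1 :=
      mul_left_cancel h
    have hk : k = k' := by
      have h2 : (if k then s else 1) * (if k' then s else 1)⁻¹ ∈ ⁅(⊤ : Subgroup G), J⁆ := by
        have h3 : (if k then s else 1) * (if k' then s else 1)⁻¹ =
            (θ (w (v r)))⁻¹ * θ (w (v r')) := by
          rw [mul_inv_eq_iff_eq_mul, mul_assoc, ← h1, inv_mul_cancel_left]
        rw [h3]
        exact Subgroup.mul_mem _ (Subgroup.inv_mem _ (hw0 _)) (hw0 _)
      cases k <;> cases k' <;> simp_all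
    subst hk
    obtain ⟨d, hd⟩ := (hθ.eq_iff _ _).1 (mul_right_cancel h1)
    have hd0 : d = 0 := by
      have := congrFun hd q
      rw [Pi.add_apply, hwq, hwq] at this
      exact this.symm
    have h2 := congrFun hd a
    have h3 := congrFun hd b
    rw [Pi.add_apply, hwa, hwa, hd0] at h2
    rw [Pi.add_apply, hwb, hwb, hd0] at h3
    rw [Prod.ext (CharTwo.add_eq_zero.1 h2) (CharTwo.add_eq_zero.1 h3)]
  have h1 : (Set.range f).ncard = 8 := by
    rw [← Set.image_univ, Set.ncard_image_of_injective _ hinj, Set.ncard_univ]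
    simp
  rw [← h1]
  refine Set.ncard_le_ncard ?_ (Set.toFinite _)
  rintro _ ⟨r, rfl⟩
  exact hf r

theorem eighty_le_ncard_conjugatesOf (hG : ConditionStar G J) (e : G ⧸ J ≃* Perm (Fin 5))
    (hc : orderOf c = 2) (hcs : (toPerm J e c).IsSwap) : 80 ≤ (conjugatesOf c).ncard := by
  classical
  have := hG.finite e
  obtain ⟨B, hB, hBs⟩ := exists_finset_isSwap
  let F : Perm (Fin 5) → Set G := fun σ => {x | IsConj c x ∧ toPerm J e x = σ}
  have hF : ∀ σ ∈ B, 8 ≤ (F σ).toFinite.toFinset.card := by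
    intro σ hσ
    rw [← Set.ncard_eq_toFinset_card]
    obtain ⟨d, hd, rfl⟩ := exists_isConj_toPerm_eq e hcs (hBs σ hσ)
    have hd2 : orderOf d = 2 := by
      obtain ⟨g, rfl⟩ := isConj_iff.1 hd
      exact ((MulAut.conj g).orderOf_eq c).trans hc
    refine (hG.eight_le_ncard_fiber e hd2 (isSwap_toPerm_of_isConj e hcs hd)).trans
      (Set.ncard_le_ncard ?_ (Set.toFinite _))
    rintro x ⟨hx, hx'⟩
    exact ⟨hd.trans hx, hx'⟩
  have hdisj : (B : Set (Perm (Fin 5))).PairwiseDisjoint fun σ => (F σ).toFinite.toFinset := by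
    intro σ _ τ _ hστ
    rw [Function.onFun, Finset.disjoint_left]
    intro x hx hx'
    rw [Set.Finite.mem_toFinset] at hx hx'
    exact hστ (hx.2.symm.trans hx'.2)
  have h1 : 80 ≤ (B.biUnion fun σ => (F σ).toFinite.toFinset).card := by
    rw [Finset.card_biUnion hdisj]
    have := Finset.card_nsmul_le_sum B _ 8 hF
    rwa [hB] at this
  refine h1.trans ?_
  rw [← Set.ncard_coe_finset]
  refine Set.ncard_le_ncard ?_ (Set.toFinite _)
  intro x hx
  obtain ⟨σ, -, hx⟩ := Finset.mem_biUnion.1 (Finset.mem_coe.1 hx)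
  rw [Set.Finite.mem_toFinset] at hx
  exact hx.1

theorem ninetySix_le_card_smallK (hG : ConditionStar G J) (e : G ⧸ J ≃* Perm (Fin 5))
    (hc : orderOf c = 2) (hcs : (toPerm J e c).IsSwap) : 96 ≤ Nat.card (smallK J c) := by
  have := hG.finite e
  have hd : Disjoint ((⁅(⊤ : Subgroup G), J⁆ : Subgroup G) : Set G) (conjugatesOf c) := by
    rw [Set.disjoint_left]
    intro x hx hx'
    have h1 := isSwap_toPerm_of_isConj e hcs hx'
    rw [toPerm_eq_one_of_mem_commutator e hx] at h1
    exact sign_ne_one_of_isSwap h1 (map_one _)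
  have h1 := hG.eighty_le_ncard_conjugatesOf e hc hcs
  have h2 : ((⁅(⊤ : Subgroup G), J⁆ : Subgroup G) : Set G).ncard = 16 := hG.card_commutator e
  rw [Nat.card_coe_set_eq, smallK, Set.ncard_union_eq hd, h2]
  omega

theorem isComplement_smallK (hG : ConditionStar G J) (e : G ⧸ J ≃* Perm (Fin 5)) (P : Sylow 5 G)
    (hc : orderOf c = 2) (hcs : (toPerm J e c).IsSwap) :
    Subgroup.IsComplement (Subgroup.normalizer (P : Set G) : Set G) (smallK J c) := by
  have := hG.finite e
  refine isComplement_of_eq_of_card_le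
    (fun x hx y hy h => hG.eq_of_mul_inv_mem_normalizer e P hc hcs hx hy h) ?_
  rw [hG.card_eq_3840 e]
  exact Nat.mul_le_mul (hG.forty_le_card_normalizer e P) (hG.ninetySix_le_card_smallK e hc hcs)

/-- The transversal property gives `|H| * |K| = 3840`, so the lower bounds `40` and `96` are both
attained. -/
theorem card_smallK (hG : ConditionStar G J) (e : G ⧸ J ≃* Perm (Fin 5)) (P : Sylow 5 G)
    (hc : orderOf c = 2) (hcs : (toPerm J e c).IsSwap) : Nat.card (smallK J c) = 96 := by
  have h1 := (hG.isComplement_smallK e P hc hcs).card_mul_card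
  have h2 : 40 ≤ Nat.card ((Subgroup.normalizer (P : Set G) : Subgroup G) : Set G) :=
    hG.forty_le_card_normalizer e P
  have h3 := hG.ninetySix_le_card_smallK e hc hcs
  rw [hG.card_eq_3840 e] at h1
  nlinarith

end ConditionStar

theorem mul_self_of_mem_smallK (hG : ConditionStar G J) (hc : orderOf c = 2) {x : G}
    (hx : x ∈ smallK J c) : x * x = 1 := by
  rcases hx with hx | hx
  · rw [← pow_two]
    exact hG.sq_eq_one x (Subgroup.commutator_le_right _ _ hx)
  · exact mul_self_eq_one_of_isConj hc hx

end SmallFolder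

/-! ### The folder `(𝓖, 𝓗, 𝓚)` -/

section LargeFolder

open Equiv

variable {G : Type*} [Group G] {J : Subgroup G} [J.Normal] {e : G ⧸ J ≃* Perm (Fin 5)} {k : ℕ}
  {c : G}

namespace ScrG

theorem ext_iff' {x y : ScrG J e k} :
    x = y ↔ (∀ i, x.left.toAdd i = y.left.toAdd i) ∧ x.right = y.right := by
  refine ⟨by rintro rfl; exact ⟨fun _ => rfl, rfl⟩, fun h => SemidirectProduct.ext ?_ h.2⟩
  exact congrArg Multiplicative.ofAdd (funext h.1)

theorem left_mul (x y : ScrG J e k) (i : Fin k) :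
    (x * y).left.toAdd i = x.left.toAdd i + gRepU J e x.right (y.left.toAdd i) := rfl

theorem left_inv (x : ScrG J e k) (i : Fin k) :
    (x⁻¹).left.toAdd i = - gRepU J e x.right⁻¹ (x.left.toAdd i) := by
  change gRepU J e x.right⁻¹ (-(x.left.toAdd i)) = _
  rw [map_neg]

theorem gRepU_gRepU (g h : G) (u : UMod) :
    gRepU J e g (gRepU J e h u) = gRepU J e (g * h) u := by
  rw [map_mul]; rfl

theorem left_mul_inv (x y : ScrG J e k) (i : Fin k) :
    (x * y⁻¹).left.toAdd i =
      x.left.toAdd i - gRepU J e (x.right * y.right⁻¹) (y.left.toAdd i) := by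
  rw [left_mul, left_inv, map_neg, gRepU_gRepU, sub_eq_add_neg]

theorem left_conj (x y : ScrG J e k) (i : Fin k) :
    (x * y * x⁻¹).left.toAdd i = x.left.toAdd i + gRepU J e x.right (y.left.toAdd i) -
      gRepU J e (x.right * y.right * x.right⁻¹) (x.left.toAdd i) := by
  rw [left_mul_inv, left_mul]; rfl

end ScrG

theorem gRepU_of_mem {j : G} (hj : j ∈ J) (u : UMod) : gRepU J e j u = u := by
  rw [gRepU_apply, (toPerm_eq_one J e).2 hj, map_one]; rfl

theorem UMod_add_self (u : UMod) : u + u = 0 := by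
  have h : (1 + 1 : ZMod 2) • u = 0 := by
    rw [show (1 + 1 : ZMod 2) = 0 by decide, zero_smul]
  rwa [add_smul, one_smul] at h

theorem UMod_neg (u : UMod) : -u = u := neg_eq_of_add_eq_zero_left (UMod_add_self u)

theorem orderOf_inr (hc : orderOf c = 2) : orderOf (SemidirectProduct.inr c : ScrG J e k) = 2 :=
  (orderOf_injective _ SemidirectProduct.inr_injective c).trans hc

/-- The conjugacy class of `c` in `𝓖`. -/
theorem isConj_inr_iff (hc : orderOf c = 2) (hcs : (toPerm J e c).IsSwap) {x : ScrG J e k} :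
    IsConj (SemidirectProduct.inr c) x ↔
      IsConj c x.right ∧ ∀ i, x.left.toAdd i ∈ fixU (toPerm J e x.right) := by
  constructor
  · intro h
    refine ⟨SemidirectProduct.rightHom.map_isConj h, fun i => ?_⟩
    have h1 := (ScrG.ext_iff'.1 (mul_self_eq_one_of_isConj (orderOf_inr hc) h)).1 i
    rw [ScrG.left_mul] at h1
    rw [mem_fixU, ← gRepU_apply, ← UMod_neg (x.left.toAdd i)]
    rw [map_neg, neg_inj]
    exact (neg_eq_of_add_eq_zero_right h1).symm.trans (UMod_neg _)
  · rintro ⟨h, hfix⟩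
    have hs := isSwap_toPerm_of_isConj e hcs h
    have h1 : IsConj (SemidirectProduct.inr c : ScrG J e k) (SemidirectProduct.inr x.right) :=
      SemidirectProduct.inr.map_isConj h
    -- Conjugation by `(u₁, 0)` adds `(u₁, 0) - σ(u₁, 0) = (u₁, σu₁)` in each coordinate, and this
    -- is the general vector fixed by `σ`.
    refine h1.trans (isConj_iff.2 ⟨SemidirectProduct.inl
      (Multiplicative.ofAdd fun i => ((x.left.toAdd i).1, 0)), ScrG.ext_iff'.2 ⟨fun i => ?_, ?_⟩⟩)
    · have h2 := hfix i
      rw [fixU_eq_graph hs, LinearMap.mem_graph_iff] at h2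
      rw [ScrG.left_conj]
      simp only [SemidirectProduct.left_inl, SemidirectProduct.right_inl,
        SemidirectProduct.left_inr, SemidirectProduct.right_inr, toAdd_ofAdd, one_mul, inv_one,
        mul_one, toAdd_one, Pi.zero_apply, map_zero, add_zero]
      rw [gRepU_apply, repU_apply_of_sign_ne (sign_ne_one_of_isSwap hs)]
      refine Prod.ext (by simp) ?_
      rw [h2, Prod.snd_sub, zero_sub]
      exact congrArg Prod.snd (UMod_neg (0, repN (toPerm J e x.right) (x.left.toAdd i).1))
    · simp

theorem mem_scrK {x : ScrG J e k} : x ∈ scrK J e k c ↔ IsConj (SemidirectProduct.inr c) x ∨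
    x.right ∈ ⁅(⊤ : Subgroup G), J⁆ ∧ ∀ i, x.left.toAdd i ∈ WSub := Iff.rfl

theorem conj_mem_scrK (g : ScrG J e k) {x : ScrG J e k} (hx : x ∈ scrK J e k c) :
    g * x * g⁻¹ ∈ scrK J e k c := by
  rw [mem_scrK] at hx ⊢
  refine hx.imp (fun h => h.trans (isConj_iff.2 ⟨g, rfl⟩)) fun h => ?_
  have h1 : g.right * x.right * g.right⁻¹ ∈ ⁅(⊤ : Subgroup G), J⁆ :=
    Subgroup.Normal.conj_mem inferInstance _ h.1 g.right
  refine ⟨h1, fun i => ?_⟩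
  rw [ScrG.left_conj, gRepU_of_mem (Subgroup.commutator_le_right _ _ h1), add_sub_cancel_left]
  exact repU_mem_WSub _ (h.2 i)

theorem one_mem_scrK : (1 : ScrG J e k) ∈ scrK J e k c :=
  Or.inr ⟨Subgroup.one_mem _, fun _ => WSub.zero_mem⟩

theorem mul_self_of_mem_scrK (hG : ConditionStar G J) (hc : orderOf c = 2) {x : ScrG J e k}
    (hx : x ∈ scrK J e k c) : x * x = 1 := by
  rcases hx with hx | ⟨hx, -⟩
  · exact mul_self_eq_one_of_isConj (orderOf_inr hc) hx
  · have hJ := Subgroup.commutator_le_right _ _ hx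
    refine ScrG.ext_iff'.2 ⟨fun i => ?_, ?_⟩
    · rw [ScrG.left_mul, gRepU_of_mem hJ, UMod_add_self]; rfl
    · rw [SemidirectProduct.mul_right, ← pow_two, hG.sq_eq_one _ hJ]; rfl

/-- The subspace of `U` over an element of `K`, in terms of which `𝓚` is described. -/
def fiberU (J : Subgroup G) [J.Normal] (e : G ⧸ J ≃* Perm (Fin 5)) (x : G) :
    Submodule (ZMod 2) UMod :=
  open scoped Classical in
  if x ∈ ⁅(⊤ : Subgroup G), J⁆ then WSub else fixU (toPerm J e x)

theorem notMem_commutator_of_isConj (hcs : (toPerm J e c).IsSwap) {x : G} (hx : IsConj c x) :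
    x ∉ ⁅(⊤ : Subgroup G), J⁆ := by
  intro h
  have h1 := isSwap_toPerm_of_isConj e hcs hx
  rw [toPerm_eq_one_of_mem_commutator e h] at h1
  exact sign_ne_one_of_isSwap h1 (map_one _)

/-- The two pieces of `𝓚` lie over disjoint subsets of `K`, since conjugates of `c` act as odd
permutations; hence one linear condition depending on `x.right` describes both. -/
theorem mem_scrK_iff (hc : orderOf c = 2) (hcs : (toPerm J e c).IsSwap) {x : ScrG J e k} :
    x ∈ scrK J e k c ↔ x.right ∈ smallK J c ∧ ∀ i, x.left.toAdd i ∈ fiberU J e x.right := by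
  rw [mem_scrK, mem_smallK, isConj_inr_iff hc hcs, fiberU]
  by_cases h : x.right ∈ ⁅(⊤ : Subgroup G), J⁆
  · have h1 : ¬ IsConj c x.right := fun h' => notMem_commutator_of_isConj hcs h' h
    simp only [h, h1, if_true, false_and, false_or, true_or, true_and]
  · simp [h]

theorem isCompl_fiberU (hcs : (toPerm J e c).IsSwap) {T : Submodule (ZMod 2) UMod}
    (hTW : IsCompl T WSub) (hT : ∀ σ : Perm (Fin 5), σ.IsSwap → IsCompl T (fixU σ)) {x : G}
    (hx : x ∈ smallK J c) : IsCompl T (fiberU J e x) := by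
  rw [fiberU]
  split_ifs with h
  · exact hTW
  · exact hT _ (isSwap_toPerm_of_isConj e hcs ((mem_smallK.1 hx).resolve_left h))

theorem existsUnique_sub_mem_of_isCompl {R M : Type*} [Ring R] [AddCommGroup M] [Module R M]
    {S T : Submodule R M} (h : IsCompl T S) (z : M) :
    ∃ s ∈ S, z - s ∈ T ∧ ∀ s' ∈ S, z - s' ∈ T → s' = s := by
  obtain ⟨t, ht, s, hs, rfl⟩ := Submodule.mem_sup.1 (h.sup_eq_top ▸ Submodule.mem_top (x := z))
  refine ⟨s, hs, by simpa using ht, fun s' hs' h' => ?_⟩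
  have h1 : s - s' ∈ T := by
    have := T.sub_mem h' ht
    rwa [show t + s - s' - t = s - s' by abel] at this
  exact (sub_eq_zero.1 (Submodule.disjoint_def.1 h.disjoint _ h1 (S.sub_mem hs hs'))).symm

/-- Since `T` is stable under `H`, the twist by `x.right * y.right⁻¹` can be moved from the
coordinates of `y` to those of `x`, leaving a linear problem in the coordinates of `y`. -/
theorem mul_inv_mem_scrH {H : Subgroup G} {T : Submodule (ZMod 2) UMod}
    {hT : ∀ h ∈ H, ∀ u ∈ T, gRepU J e h u ∈ T} {x y : ScrG J e k} :
    x * y⁻¹ ∈ scrH J e k H T hT ↔ x.right * y.right⁻¹ ∈ H ∧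
      ∀ i, gRepU J e (x.right * y.right⁻¹)⁻¹ (x.left.toAdd i) - y.left.toAdd i ∈ T := by
  refine and_congr_right fun h => forall_congr' fun i => ?_
  have hr : (x * y⁻¹).right = x.right * y.right⁻¹ := rfl
  rw [hr] at h
  rw [ScrG.left_mul_inv]
  generalize x.right * y.right⁻¹ = a at *
  constructor
  · intro hm
    have := hT _ (H.inv_mem h) _ hm
    rwa [map_sub, ScrG.gRepU_gRepU _ _ (y.left.toAdd i), inv_mul_cancel,
      gRepU_of_mem J.one_mem] at this
  · intro hm
    have := hT _ h _ hm
    rwa [map_sub, ScrG.gRepU_gRepU, mul_inv_cancel, gRepU_of_mem J.one_mem] at this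

theorem isComplement_scrK (hc : orderOf c = 2) (hcs : (toPerm J e c).IsSwap) {H : Subgroup G}
    {T : Submodule (ZMod 2) UMod} (hT : ∀ h ∈ H, ∀ u ∈ T, gRepU J e h u ∈ T)
    (hTW : IsCompl T WSub) (hTσ : ∀ σ : Perm (Fin 5), σ.IsSwap → IsCompl T (fixU σ))
    (hK : Subgroup.IsComplement (H : Set G) (smallK J c)) :
    Subgroup.IsComplement (scrH J e k H T hT : Set (ScrG J e k)) (scrK J e k c) := by
  rw [Subgroup.isComplement_iff_existsUnique_mul_inv_mem] at hK ⊢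
  intro x
  -- The component in `G` of the representative is forced first. Over it, each coordinate is the
  -- projection along `T` onto the fibre at `a`.
  obtain ⟨⟨a, ha⟩, hxa, hu⟩ := hK x.right
  have hcompl := isCompl_fiberU hcs hTW hTσ ha
  choose s hs hsT hsu using fun i => existsUnique_sub_mem_of_isCompl hcompl
    (gRepU J e (x.right * a⁻¹)⁻¹ (x.left.toAdd i))
  refine ⟨⟨⟨Multiplicative.ofAdd s, a⟩, (mem_scrK_iff hc hcs).2 ⟨ha, hs⟩⟩,
    mul_inv_mem_scrH.2 ⟨hxa, hsT⟩, ?_⟩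
  rintro ⟨y, hy⟩ hxy
  obtain ⟨h1, h2⟩ := mul_inv_mem_scrH.1 hxy
  obtain ⟨h3, h4⟩ := (mem_scrK_iff hc hcs).1 hy
  have h5 : y.right = a := congrArg Subtype.val (hu ⟨y.right, h3⟩ h1)
  simp only at h2
  rw [h5] at h2 h4
  exact Subtype.ext (ScrG.ext_iff'.2 ⟨fun i => hsu i _ (h4 i) (h2 i), h5⟩)

theorem inr_mem_scrK (hc : orderOf c = 2) (hcs : (toPerm J e c).IsSwap) {x : G}
    (hx : x ∈ smallK J c) : (SemidirectProduct.inr x : ScrG J e k) ∈ scrK J e k c :=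
  (mem_scrK_iff hc hcs).2 ⟨hx, fun _ => Submodule.zero_mem _⟩

theorem isSurjectiveFolderHom_rightHom (hc : orderOf c = 2) (hcs : (toPerm J e c).IsSwap)
    {H : Subgroup G} {T : Submodule (ZMod 2) UMod} (hT : ∀ h ∈ H, ∀ u ∈ T, gRepU J e h u ∈ T) :
    IsSurjectiveFolderHom (scrH J e k H T hT) (scrK J e k c) H (smallK J c)
      (SemidirectProduct.rightHom : ScrG J e k →* G) := by
  refine ⟨SemidirectProduct.rightHom_surjective, ?_, ?_⟩
  · ext h
    constructor
    · rintro ⟨x, hx, rfl⟩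
      exact hx.1
    · exact fun hh => ⟨SemidirectProduct.inr h, ⟨hh, fun _ => T.zero_mem⟩, rfl⟩
  · ext x
    constructor
    · rintro ⟨y, hy, rfl⟩
      exact ((mem_scrK_iff hc hcs).1 hy).1
    · exact fun hx => ⟨SemidirectProduct.inr x, inr_mem_scrK hc hcs hx, rfl⟩

theorem finrank_WSub : Module.finrank (ZMod 2) WSub = 4 := by
  rw [WSub_eq_graph, finrank_graph]

/-- The loop of `(𝓖, 𝓗, 𝓚)` is an extension of `𝔽₂^{4k}` by the loop of `(G, H, K)`. -/
theorem exists_isLoopExtension (hc : orderOf c = 2) (hcs : (toPerm J e c).IsSwap)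
    {H : Subgroup G} {T : Submodule (ZMod 2) UMod} (hT : ∀ h ∈ H, ∀ u ∈ T, gRepU J e h u ∈ T)
    (h𝓖 : IsLoopFolder (scrH J e k H T hT) (scrK J e k c)) (hG : IsLoopFolder H (smallK J c)) :
    ∃ (p : h𝓖.Q →* hG.Q) (ι : Multiplicative (Fin (4 * k) → ZMod 2) →* h𝓖.Q),
      (∀ q : h𝓖.Q, IsLoopFolder.val (p q) = (IsLoopFolder.val q).right) ∧
      IsLoopExtension ι p := by
  have hr : ∀ q : h𝓖.Q, (IsLoopFolder.val q).right ∈ smallK J c := fun q =>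
    ((mem_scrK_iff hc hcs).1 (IsLoopFolder.val_mem q)).1
  let p : h𝓖.Q →* hG.Q :=
    { toFun := fun q => hG.ofMem _ (hr q)
      map_one' := rfl
      map_mul' := fun x y => by
        refine (hG.rep_eq_ofMem (hr (x * y)) ?_).symm
        exact (h𝓖.mul_inv_val_rep_mem (IsLoopFolder.val x * IsLoopFolder.val y)).1 }
  have : Module.Free (ZMod 2) WSub := Module.Free.of_divisionRing (ZMod 2) WSub
  -- The kernel consists of the elements of `𝓚` over `1`, that is `W^k`, and `W` has dimension `4`.
  let E : (Fin (4 * k) → ZMod 2) ≃ₗ[ZMod 2] (Fin k → WSub) :=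
    LinearEquiv.ofFinrankEq _ _ (by
      rw [Module.finrank_pi, Module.finrank_pi_fintype, Finset.sum_congr rfl fun _ _ => finrank_WSub]
      simp [mul_comm])
  let u : (Fin (4 * k) → ZMod 2) → ScrG J e k := fun a =>
    SemidirectProduct.inl (Multiplicative.ofAdd fun i => (E a i : UMod))
  have hu : ∀ a, u a ∈ scrK J e k c := fun a =>
    Or.inr ⟨Subgroup.one_mem _, fun i => (E a i).2⟩
  have hadd : ∀ a b, u (a + b) = u a * u b := fun a b => by
    rw [← map_mul, ← ofAdd_add]
    simp only [u, map_add]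
    rfl
  let ι : Multiplicative (Fin (4 * k) → ZMod 2) →* h𝓖.Q :=
    { toFun := fun a => h𝓖.ofMem _ (hu a.toAdd)
      map_one' := by
        refine h𝓖.val_injective (ScrG.ext_iff'.2 ⟨fun i => ?_, rfl⟩)
        change ((E 0 i : WSub) : UMod) = 0
        rw [map_zero]; rfl
      map_mul' := fun a b => by
        refine (h𝓖.rep_eq_ofMem (hu _) ?_).symm
        rw [toAdd_mul, hadd, IsLoopFolder.val_ofMem, IsLoopFolder.val_ofMem, mul_inv_cancel]
        exact Subgroup.one_mem _ }
  refine ⟨p, ι, fun _ => rfl, fun a b h => ?_, fun q => ?_, fun q => ⟨fun h => ?_, ?_⟩⟩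
  · have h1 := (ScrG.ext_iff'.1 (congrArg IsLoopFolder.val h)).1
    exact E.injective (funext fun i => Subtype.ext (h1 i))
  · exact ⟨h𝓖.ofMem _ (inr_mem_scrK hc hcs (IsLoopFolder.val_mem q)), rfl⟩
  · have h1 : (IsLoopFolder.val q).right = 1 := congrArg IsLoopFolder.val h
    have h2 : ∀ i, (IsLoopFolder.val q).left.toAdd i ∈ WSub := by
      rcases mem_scrK.1 (IsLoopFolder.val_mem q) with h3 | h3
      · have h4 := ((isConj_inr_iff hc hcs).1 h3).1
        rw [h1] at h4
        exact absurd (Subgroup.one_mem _) (notMem_commutator_of_isConj hcs h4)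
      · exact h3.2
    refine ⟨Multiplicative.ofAdd (E.symm fun i => ⟨_, h2 i⟩), h𝓖.val_injective
      (ScrG.ext_iff'.2 ⟨fun i => ?_, h1.symm⟩)⟩
    change ((E (E.symm fun i => ⟨_, h2 i⟩) i : WSub) : UMod) = _
    rw [E.apply_symm_apply]
  · rintro ⟨a, rfl⟩
    rfl

end LargeFolder

end

theorem mainTheorem5 {G : Type*} [Group G] (J : Subgroup G) [J.Normal] (hG : ConditionStar G J)
    (e : G ⧸ J ≃* Equiv.Perm (Fin 5)) (P : Sylow 5 G)
    (H : Subgroup G) (hH : H = Subgroup.normalizer (P : Set G))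
    (c : G) (hc : orderOf c = 2) (hcG : c ∉ commutator G ⊔ J)
    (T : Submodule (ZMod 2) UMod) (hT : ∀ h ∈ H, ∀ u ∈ T, gRepU J e h u ∈ T)
    (hT_bot : T ≠ ⊥) (hT_top : T ≠ ⊤) (hT_W : T ≠ WSub)
    (k : ℕ) (hk : 0 < k) :
    IsBolLoopFolder (scrH J e k H T hT) (scrK J e k c) ∧
    IsOneUnionInvolutionClasses (scrK J e k c) ∧
    IsBolLoopFolder H (smallK J c) ∧
    Nat.card (smallK J c) = 96 ∧
    IsSurjectiveFolderHom (scrH J e k H T hT) (scrK J e k c) H (smallK J c)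
      (SemidirectProduct.rightHom : ScrG J e k →* G) ∧
    (SemidirectProduct.rightHom : ScrG J e k →* G).ker =
      (SemidirectProduct.inl : Multiplicative (Fin k → UMod) →* ScrG J e k).range ∧
    ∃ (h𝓖 : IsLoopFolder (scrH J e k H T hT) (scrK J e k c)) (hG' : IsLoopFolder H (smallK J c))
      (p : h𝓖.Q →* hG'.Q) (ι : Multiplicative (Fin (4 * k) → ZMod 2) →* h𝓖.Q),
      (∀ q : h𝓖.Q, IsLoopFolder.val (p q) = (IsLoopFolder.val q).right) ∧
      IsLoopExtension ι p := by
  have hcs := isSwap_toPerm e hc hcG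
  have hc1 : c ≠ 1 := by
    rintro rfl
    simp at hc
  obtain ⟨hTW, hTσ⟩ : IsCompl T WSub ∧ ∀ σ : Equiv.Perm (Fin 5), σ.IsSwap → IsCompl T (fixU σ) := by
    obtain ⟨π, ⟨r, hr, hrπ⟩, d, hd, hdπ⟩ := hG.exists_normalizer_rot_dbl e P
    rw [← hH] at hr hd
    refine isCompl_of_conj_rot_dbl π (fun u hu => ?_) (fun u hu => ?_) hT_bot hT_top hT_W
    · rw [← conj_inv, ← hrπ, ← map_inv]
      exact hT _ (H.inv_mem hr) u hu
    · rw [← conj_inv, ← hdπ, ← map_inv]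
      exact hT _ (H.inv_mem hd) u hu
  have hK : Subgroup.IsComplement (H : Set G) (smallK J c) := by
    rw [hH]
    exact hG.isComplement_smallK e P hc hcs
  have h𝓚 := isComplement_scrK (k := k) hc hcs hT hTW hTσ hK
  have h1 : (1 : G) ∈ smallK J c := Or.inl (Subgroup.one_mem _)
  have hcK : c ∈ smallK J c := Or.inr (IsConj.refl c)
  obtain ⟨p, ι, h⟩ := exists_isLoopExtension hc hcs hT
    (isLoopFolder_of_conj_mem one_mem_scrK (fun g _ hx => conj_mem_scrK g hx) h𝓚)
    (isLoopFolder_of_conj_mem h1 (fun g _ hx => conj_mem_smallK g hx) hK)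
  refine ⟨isBolLoopFolder_of_conj_mem one_mem_scrK (fun g _ hx => conj_mem_scrK g hx) h𝓚
      (fun _ hx => mul_self_of_mem_scrK hG hc hx)
      ⟨_, inr_mem_scrK hc hcs hcK, fun h' =>
        hc1 (SemidirectProduct.inr_injective (h'.trans (map_one _).symm))⟩,
    isOneUnionInvolutionClasses_of_conj_mem one_mem_scrK (fun g _ hx => conj_mem_scrK g hx)
      (fun _ hx => mul_self_of_mem_scrK hG hc hx),
    isBolLoopFolder_of_conj_mem h1 (fun g _ hx => conj_mem_smallK g hx) hK
      (fun _ hx => mul_self_of_mem_smallK hG hc hx) ⟨c, hcK, hc1⟩,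
    hG.card_smallK e P hc hcs, isSurjectiveFolderHom_rightHom hc hcs hT,
    SemidirectProduct.range_inl_eq_ker_rightHom.symm, _, _, p, ι, h⟩
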